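/- **Setting.** A multi-edge-type D-GLDPC ensemble has $n_e$ edge types and finitely many types of variable nodes (VNs) $\gamma$ and check nodes (CNs) $\delta$. A VN type consists of a binary linear $(q_\gamma,k_\gamma)$ code with a fixed full-rank generator matrix $G_\gamma$, an edge type for each of its $q_\gamma$ sockets (code positions), and a set of punctured information bits. A CN type consists of a binary linear code with generator matrix $G_\delta$ and an edge type for each of its sockets. Let $q_{\gamma,l}$, $s_{\delta,l}$ be the numbers of sockets of type $l$, and let $\lambda_{\gamma,l},\rho_{\delta,l}\ge 0$ be the fractions of the edges of type $l$ connected to VNs of type $\gamma$, resp. CNs of type $\delta$; thus $\sum_\gamma\lambda_{\gamma,l}=\sum_\delta\rho_{\delta,l}=1$, and $\lambda_{\gamma,l}>0\iff q_{\gamma,l}>0$, $\rho_{\delta,l}>0\iff s_{\delta,l}>0$. Assume that no information bit is punctured and that every VN and CN code has minimum distance at least $2$. Let $\epsilon\in[0,1]$ be the erasure probability of the binary erasure channel. **EXIT recursion.** For $\mathbf g\in\mathbb N^{n_e}$ let $\tilde e^{(\delta)}_{\mathbf g}$ be the sum of the ranks of all submatrices of $G_\delta$ formed by exactly $g_l$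 columns of type $l$ for every $l$, and let $\tilde e^{(\gamma)}_{\mathbf g;u}$ be the sum of the ranks of all matrices formed by exactly $g_l$ columns of type $l$ of $G_\gamma$ for every $l$, together with $u$ of the $k_\gamma$ columns of the identity matrix. Write $\mathbf q_\gamma=(q_{\gamma,l})_l$, $\mathbf s_\delta=(s_{\delta,l})_l$, and let $\mathbf 1_e$ be the $e$-th unit vector. For $I\in\mathbb R^{n_e}$ put, whenever $q_{\gamma,e}>0$, resp. $s_{\delta,e}>0$, $$I^{(\gamma)}_{EV,e}(I,\epsilon)=1-\frac1{q_{\gamma,e}}\sum_{z=0}^{k_\gamma}\epsilon^z(1-\epsilon)^{k_\gamma-z}\sum_{\mathbf 0\le\mathbf t\le\mathbf q_\gamma-\mathbf 1_e}\Big(\prod_l(1-I_l)^{t_l}I_l^{(\mathbf q_\gamma-\mathbf 1_e-\mathbf t)_l}\Big)\Big[(q_{\gamma,e}-t_e)\,\tilde e^{(\gamma)}_{\mathbf q_\gamma-\mathbf t;\,k_\gamma-z}-(t_e+1)\,\tilde e^{(\gamma)}_{\mathbf q_\gamma-\mathbf t-\mathbf 1_e;\,k_\gamma-z}\Big],$$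 $$I^{(\delta)}_{EC,e}(I)=1-\frac1{s_{\delta,e}}\sum_{\mathbf 0\le\mathbf t\le\mathbf s_\delta-\mathbf 1_e}\Big(\prod_l(1-I_l)^{t_l}I_l^{(\mathbf s_\delta-\mathbf 1_e-\mathbf t)_l}\Big)\Big[(s_{\delta,e}-t_e)\,\tilde e^{(\delta)}_{\mathbf s_\delta-\mathbf t}-(t_e+1)\,\tilde e^{(\delta)}_{\mathbf s_\delta-\mathbf t-\mathbf 1_e}\Big].$$ Let $I_{EV,e}=\sum_\gamma\lambda_{\gamma,e}I^{(\gamma)}_{EV,e}$ and $I_{EC,e}=\sum_\delta\rho_{\delta,e}I^{(\delta)}_{EC,e}$, where terms with $\lambda_{\gamma,e}=0$, resp. $\rho_{\delta,e}=0$, are omitted. The EXIT recursion on $[0,1]^{n_e}$ is $I^{\ell+1}=f(I^\ell,\epsilon)$ with $f(I,\epsilon)=I_{EV}(I_{EC}(I),\epsilon)$. **Matrices.** Let $\xi_2^{(\delta)}(l,m)$ be the number of ordered pairs of distinct sockets of a CN of type $\delta$, the first of type $l$ and the second of type $m$, that form the support of a weight-2 local codeword, and let $\chi_{2,u}^{(\gamma)}(l,m)$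 be the corresponding number for a VN of type $\gamma$ and local codewords generated through $G_\gamma$ by an input word of weight $u$. Put $$C^{l,m}=\sum_{\delta}\frac{\rho_{\delta,l}}{s_{\delta,l}}\,\xi_2^{(\delta)}(l,m),\qquad P^{l,m}(x)=\sum_{\gamma}\frac{\lambda_{\gamma,l}}{q_{\gamma,l}}\sum_{u=1}^{k_\gamma}\chi^{(\gamma)}_{2,u}(l,m)\,x^u,$$ where the sums are over the CN, resp. VN, types of minimum distance exactly $2$, and types without sockets of type $l$ contribute $0$. Let $C=(C^{l,m})$, $P(\epsilon)=(P^{l,m}(\epsilon))$, and let $\sigma$ denote the spectral radius. **Theorem.** The erasure-free state $\mathbf 1=(1,\dots,1)$ is a fixed point of $f(\cdot,\epsilon)$, and the Jacobian matrix of $f(\cdot,\epsilon)$ at $\mathbf 1$ is $P(\epsilon)C$. The fixed point $\mathbf 1$ is locally stable if and only if $\sigma(P(\epsilon)C)<1$; here *locally stable* means that it attracts nearby states at a geometric rate: there are $r>0$, $K$ and $0\le\theta<1$ such that $\|I^\ell-\mathbf 1\|\le K\theta^\ell\|I^0-\mathbf 1\|$ for all $\ell\ge 0$ and all $I^0\in[0,1]^{n_e}$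 with $\|I^0-\mathbf 1\|<r$. In particular, if $\sigma(P(\epsilon)C)<1$, then $\mathbf 1$ is Lyapunov stable and a local attractor of the recursion on $[0,1]^{n_e}$. If $\sigma(P(\epsilon)C)>1$, then $\mathbf 1$ is neither Lyapunov stable nor a local attractor of the recursion on $[0,1]^{n_e}$. -/

import Mathlib

open Finset Filter Topology Polynomial

noncomputable section

/-! ### Binary component codes -/

/-- A binary linear `(len, dim)` code, given by a generator matrix (an encoder): a
`dim × len` matrix over the field with two elements whose rank is `dim`. -/
structure ComponentCode where
  /-- code length -/
  len : ℕ
  /-- code dimension -/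
  dim : ℕ
  /-- generator matrix -/
  gen : Matrix (Fin dim) (Fin len) (ZMod 2)
  rank_gen : gen.rank = dim

namespace ComponentCode

/-- The local codeword generated by the local input word `x`. -/
def encode (K : ComponentCode) (x : Fin K.dim → ZMod 2) : Fin K.len → ZMod 2 :=
  Matrix.vecMul x K.gen

/-- `c` is a codeword. -/
def IsCodeword (K : ComponentCode) (c : Fin K.len → ZMod 2) : Prop :=
  ∃ x, K.encode x = c

/-- The minimum distance: the least Hamming weight of a nonzero codeword
(`⊤` for the code whose only codeword is `0`). -/
def minDist (K : ComponentCode) : ℕ∞ :=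
  ⨅ (c : Fin K.len → ZMod 2) (_ : K.IsCodeword c) (_ : c ≠ 0), (hammingNorm c : ℕ∞)

/-- The word with a `1` in positions `i` and `j` and a `0` elsewhere (for `i ≠ j`). -/
def pairWord (K : ComponentCode) (i j : Fin K.len) : Fin K.len → ZMod 2 :=
  fun m => if m = i ∨ m = j then 1 else 0

end ComponentCode

/-! ### Node types -/

/-- A type of variable nodes, for `ne` edge types: a component code with a specific encoder, a
puncturing pattern (`notPunctured i = true` iff the `i`-th information bit is not punctured) and
the edge types of the sockets. -/
structure VNType (ne : ℕ) where
  code : ComponentCode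
  notPunctured : Fin code.dim → Bool
  edgeType : Fin code.len → Fin ne

/-- A type of check nodes, for `ne` edge types: a component code (any generator matrix of it) and
the edge types of the sockets. -/
structure CNType (ne : ℕ) where
  code : ComponentCode
  edgeType : Fin code.len → Fin ne

/-- The vector of length `ne` whose entries are `0`, except for a `1` in position `e`. -/
def unitVec {ne : ℕ} (e : Fin ne) : Fin ne → ℕ := Pi.single e 1

namespace VNType

variable {ne : ℕ}

/-- The number of sockets of type `l`. -/
def q (T : VNType ne) (l : Fin ne) : ℕ := #{i | T.edgeType i = l}

/-- The number of information bits that are not punctured. -/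
def b (T : VNType ne) : ℕ := #{i | T.notPunctured i = true}

/-- The number of ordered pairs of sockets, the first of type `l`, the second of type `m`, that are
the support of a weight-2 local codeword generated by an input word of weight `u`. -/
def chi (T : VNType ne) (u : ℕ) (l m : Fin ne) : ℕ :=
  open Classical in
  #{p : Fin T.code.len × Fin T.code.len |
      p.1 ≠ p.2 ∧ T.edgeType p.1 = l ∧ T.edgeType p.2 = m ∧
        ∃ x, hammingNorm x = u ∧ T.code.encode x = T.code.pairWord p.1 p.2}

/-- The multi-type split information function: the sum of the ranks of all matrices formed by
`g l` columns of type `l` of the generator matrix, for every `l`, and by `u` of the columns of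
the identity matrix that correspond to information bits that are not punctured. -/
def splitInfo (T : VNType ne) (g : Fin ne → ℕ) (u : ℕ) : ℝ :=
  ∑ S : Finset (Fin T.code.len) with ∀ l, #{i ∈ S | T.edgeType i = l} = g l,
    ∑ U : Finset (Fin T.code.dim) with (∀ i ∈ U, T.notPunctured i = true) ∧ #U = u,
      ((Matrix.fromCols
        (T.code.gen.submatrix id (fun i : S => (i : Fin T.code.len)))
        ((1 : Matrix (Fin T.code.dim) (Fin T.code.dim) (ZMod 2)).submatrix id
          (fun i : U => (i : Fin T.code.dim)))).rank : ℝ)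

/-- The coefficients `a` of the EXIT function of a variable node. -/
def a (T : VNType ne) (e : Fin ne) (t : Fin ne → ℕ) (z : ℕ) : ℝ :=
  ((T.q e : ℝ) - t e) * T.splitInfo (T.q - t) (T.b - z)
    - ((t e : ℝ) + 1) * T.splitInfo (T.q - t - unitVec e) (T.b - z)

/-- The EXIT function of a variable node for edge type `e`. The index `t` runs over the tuples with
`0 ≤ t l ≤ q l` for `l ≠ e` and `0 ≤ t e ≤ q e - 1`. -/
def exit (T : VNType ne) (e : Fin ne) (I : Fin ne → ℝ) (ε : ℝ) : ℝ :=
  1 - 1 / (T.q e : ℝ) * ∑ z ∈ range (T.b + 1), ε ^ z * (1 - ε) ^ (T.b - z) *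
    ∑ t ∈ Fintype.piFinset (fun l => range (T.q l + 1 - unitVec e l)),
      (∏ l, (1 - I l) ^ t l * I l ^ (T.q l - unitVec e l - t l)) * T.a e t z

end VNType

namespace CNType

variable {ne : ℕ}

/-- The number of sockets of type `l`. -/
def s (T : CNType ne) (l : Fin ne) : ℕ := #{i | T.edgeType i = l}

/-- The number of ordered pairs of sockets, the first of type `l`, the second of type `m`, that are
the support of a weight-2 local codeword. -/
def xi (T : CNType ne) (l m : Fin ne) : ℕ :=
  open Classical in
  #{p : Fin T.code.len × Fin T.code.len |
      p.1 ≠ p.2 ∧ T.edgeType p.1 = l ∧ T.edgeType p.2 = m ∧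
        T.code.IsCodeword (T.code.pairWord p.1 p.2)}

/-- The multi-type information function: the sum of the ranks of all matrices formed by
`g l` columns of type `l` of the generator matrix, for every `l`. -/
def info (T : CNType ne) (g : Fin ne → ℕ) : ℝ :=
  ∑ S : Finset (Fin T.code.len) with ∀ l, #{i ∈ S | T.edgeType i = l} = g l,
    ((T.code.gen.submatrix id (fun i : S => (i : Fin T.code.len))).rank : ℝ)

/-- The coefficients `a` of the EXIT function of a check node. -/
def a (T : CNType ne) (e : Fin ne) (t : Fin ne → ℕ) : ℝ :=
  ((T.s e : ℝ) - t e) * T.info (T.s - t) - ((t e : ℝ) + 1) * T.info (T.s - t - unitVec e)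

/-- The EXIT function of a check node for edge type `e`. The index `t` runs over the tuples with
`0 ≤ t l ≤ s l` for `l ≠ e` and `0 ≤ t e ≤ s e - 1`. -/
def exit (T : CNType ne) (e : Fin ne) (I : Fin ne → ℝ) : ℝ :=
  1 - 1 / (T.s e : ℝ) *
    ∑ t ∈ Fintype.piFinset (fun l => range (T.s l + 1 - unitVec e l)),
      (∏ l, (1 - I l) ^ t l * I l ^ (T.s l - unitVec e l - t l)) * T.a e t

end CNType

/-! ### Ensembles -/

/-- A multi-edge-type D-GLDPC ensemble with `ne` edge types, variable node types indexed by `V` and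
check node types indexed by `C`; `lam γ l` (`rho δ l`) is the fraction of the edges of type `l`
that are connected to variable nodes of type `γ` (to check nodes of type `δ`). -/
structure METEnsemble (ne : ℕ) (V C : Type*) [Fintype V] [Fintype C] where
  vn : V → VNType ne
  cn : C → CNType ne
  lam : V → Fin ne → ℝ
  rho : C → Fin ne → ℝ
  lam_nonneg : ∀ γ l, 0 ≤ lam γ l
  rho_nonneg : ∀ δ l, 0 ≤ rho δ l
  lam_pos_iff : ∀ γ l, 0 < lam γ l ↔ 0 < (vn γ).q l
  rho_pos_iff : ∀ δ l, 0 < rho δ l ↔ 0 < (cn δ).s l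
  sum_lam : ∀ l, ∑ γ, lam γ l = 1
  sum_rho : ∀ l, ∑ δ, rho δ l = 1

namespace METEnsemble

variable {ne : ℕ} {V C : Type*} [Fintype V] [Fintype C]

/-- The constants `C^{l,m}`, as a matrix. A node type without sockets of type `l` contributes `0`,
because `x / 0 = 0`. -/
def matC (𝓔 : METEnsemble ne V C) : Matrix (Fin ne) (Fin ne) ℝ :=
  open Classical in
  Matrix.of fun l m =>
    ∑ δ : C with (𝓔.cn δ).code.minDist = 2,
      𝓔.rho δ l / ((𝓔.cn δ).s l : ℝ) * ((𝓔.cn δ).xi l m : ℝ)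

/-- The matrix of the polynomials `P^{l,m}`. A node type without sockets of type `l` contributes
`0`, because `x / 0 = 0`. -/
def polyP (𝓔 : METEnsemble ne V C) : Matrix (Fin ne) (Fin ne) ℝ[X] :=
  open Classical in
  Matrix.of fun l m =>
    ∑ γ : V with (𝓔.vn γ).code.minDist = 2,
      Polynomial.C (𝓔.lam γ l / ((𝓔.vn γ).q l : ℝ)) *
        ∑ u ∈ Icc 1 (𝓔.vn γ).code.dim, Polynomial.C ((𝓔.vn γ).chi u l m : ℝ) * X ^ u

/-- The matrix `P(ε)`. -/
def matP (𝓔 : METEnsemble ne V C) (ε : ℝ) : Matrix (Fin ne) (Fin ne) ℝ :=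
  𝓔.polyP.map (Polynomial.eval ε)

/-- The EXIT function of the set of variable nodes. -/
def exitV (𝓔 : METEnsemble ne V C) (I : Fin ne → ℝ) (ε : ℝ) : Fin ne → ℝ :=
  fun e => ∑ γ, 𝓔.lam γ e * (𝓔.vn γ).exit e I ε

/-- The EXIT function of the set of check nodes. -/
def exitC (𝓔 : METEnsemble ne V C) (I : Fin ne → ℝ) : Fin ne → ℝ :=
  fun e => ∑ δ, 𝓔.rho δ e * (𝓔.cn δ).exit e I

/-- The right-hand side `f(·, ε)` of the EXIT recursion `I ↦ f(I, ε)`, for the average extrinsic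
information outgoing from the set of variable nodes. -/
def exitMap (𝓔 : METEnsemble ne V C) (ε : ℝ) (I : Fin ne → ℝ) : Fin ne → ℝ :=
  𝓔.exitV (𝓔.exitC I) ε

end METEnsemble

/-- The spectral radius of a real square matrix: the largest modulus of a complex eigenvalue. -/
def specRad {n : ℕ} (A : Matrix (Fin n) (Fin n) ℝ) : ENNReal :=
  spectralRadius ℂ (A.map (fun r : ℝ => (r : ℂ)))

/-! ### Stability of a fixed point of a discrete dynamical system with state space `S` -/

/-- Lyapunov stability: trajectories that start close to `p` remain close to `p`. -/
def IsLyapunovStable {E : Type*} [PseudoMetricSpace E] (F : E → E) (S : Set E) (p : E) : Prop :=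
  ∀ η > 0, ∃ r > 0, ∀ x ∈ S, dist x p < r → ∀ n : ℕ, dist (F^[n] x) p < η

/-- `p` is a local attractor: trajectories that start close to `p` converge to `p`. -/
def IsLocalAttractor {E : Type*} [PseudoMetricSpace E] (F : E → E) (S : Set E) (p : E) : Prop :=
  ∃ r > 0, ∀ x ∈ S, dist x p < r → Tendsto (fun n : ℕ => F^[n] x) atTop (𝓝 p)

/-- Local (exponential) stability: trajectories that start close to `p` converge to `p` at a
geometric rate, with a bound proportional to the initial perturbation. -/
def IsLocallyStable {E : Type*} [PseudoMetricSpace E] (F : E → E) (S : Set E) (p : E) : Prop :=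
  ∃ r > 0, ∃ K θ : ℝ, 0 ≤ θ ∧ θ < 1 ∧
    ∀ x ∈ S, dist x p < r → ∀ n : ℕ, dist (F^[n] x) p ≤ K * θ ^ n * dist x p

end

/-! The EXIT functions are expectations of rank increments. Let `j` be a socket of type `e`, and let
every other socket `i` belong to a random set `S` independently with probability `I (τ i)`. Double
counting turns the bracket in the EXIT formula into a sum over `j` of the rank gained by adding
column `j` to the columns in `S` (`sum_profile_eq_sum_bernoulliSum`). For variable nodes there is a
further average over the random set `U` of unerased information bits.

An increment is 0 or 1 and decreases as `S` grows, so the recursion is a monotone self-map of the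
cube. At the all-one point the derivative sees only sets that lack at most one socket. By linear
duality the increment is 1 exactly when some input word vanishes on `U` and its codeword is 1 at `j`
and 0 on `S`. Minimum distance at least 2 excludes this when `S` is full. When `S` lacks only `k`,
it forces the codeword to be the weight-2 word on `j`, `k`. Its input word `x` is unique, and `U`
avoids the support of `x` with probability ε to the weight of `x`. This yields the matrices `P(ε)`
and `C`, and the chain rule yields their product.

If the spectral radius is below 1, Gelfand's formula makes some power of the Jacobian a contraction
(`isLocallyStable_of_norm_pow_lt_one`). Conversely, a geometric rate on the cube passes to the
derivatives of the iterates, first in nonnegative directions and then in all, which forces every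
eigenvalue inside the open unit disc; this also settles spectral radius 1. If the radius exceeds 1,
the entrywise modulus of an eigenvector is a nonnegative direction expanded by the nonnegative
Jacobian, and monotonicity carries the linear expansion over to the nonlinear orbit
(`exists_repelling`). -/

/-! ### Expectations of set functions under product Bernoulli measures -/

section Bernoulli

variable {ι : Type*} [DecidableEq ι]

/-- The expectation of `h S`, where `S` is a random subset of `s` that contains each `i ∈ s`
independently with probability `p i`. -/
def bernoulliSum (p : ι → ℝ) (s : Finset ι) (h : Finset ι → ℝ) : ℝ :=
  ∑ S ∈ s.powerset, (∏ i ∈ S, p i) * (∏ i ∈ s \ S, (1 - p i)) * h S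

theorem bernoulliSum_empty (p : ι → ℝ) (h : Finset ι → ℝ) : bernoulliSum p ∅ h = h ∅ := by
  simp [bernoulliSum]

/-- Condition on whether `a` lies in the random set; this recursion drives the inductions below. -/
theorem bernoulliSum_insert (p : ι → ℝ) {s : Finset ι} {a : ι} (ha : a ∉ s)
    (h : Finset ι → ℝ) :
    bernoulliSum p (insert a s) h =
      (1 - p a) * bernoulliSum p s h + p a * bernoulliSum p s (fun S => h (insert a S)) := by
  unfold bernoulliSum
  rw [Finset.sum_powerset_insert ha, Finset.mul_sum, Finset.mul_sum]
  congr 1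
  · refine Finset.sum_congr rfl fun S hS => ?_
    have haS : a ∉ S := fun h' => ha (Finset.mem_powerset.1 hS h')
    rw [Finset.insert_sdiff_of_notMem _ haS, Finset.prod_insert (by simp [ha])]
    ring
  · refine Finset.sum_congr rfl fun S hS => ?_
    have haS : a ∉ S := fun h' => ha (Finset.mem_powerset.1 hS h')
    have : insert a s \ insert a S = s \ S := by
      ext x
      by_cases hx : x = a
      · subst hx; simp [ha]
      · simp [hx]
    rw [this, Finset.prod_insert haS]
    ring

theorem bernoulliSum_one (s : Finset ι) (h : Finset ι → ℝ) : bernoulliSum 1 s h = h s := by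
  induction s using Finset.induction_on generalizing h with
  | empty => exact bernoulliSum_empty _ _
  | insert a s ha ih => simp [bernoulliSum_insert _ ha, ih]

theorem bernoulliSum_const (p : ι → ℝ) (s : Finset ι) (c : ℝ) :
    bernoulliSum p s (fun _ => c) = c := by
  induction s using Finset.induction_on with
  | empty => exact bernoulliSum_empty _ _
  | insert a s ha ih => rw [bernoulliSum_insert _ ha, ih]; ring

theorem bernoulliSum_mono {p : ι → ℝ} (hp : p ∈ Set.Icc (0 : ι → ℝ) 1) (s : Finset ι)
    {h h' : Finset ι → ℝ} (hh : ∀ S, h S ≤ h' S) : bernoulliSum p s h ≤ bernoulliSum p s h' := by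
  refine Finset.sum_le_sum fun S _ => mul_le_mul_of_nonneg_left (hh S) ?_
  exact mul_nonneg (Finset.prod_nonneg fun i _ => hp.1 i)
    (Finset.prod_nonneg fun i _ => sub_nonneg.2 (hp.2 i))

/-- Induction handles the two conditional expectations given `a ∉ S` and `a ∈ S`. Moving the mass
`p' a - p a` from the first case to the second only lowers the value, since `h` is antitone. -/
theorem bernoulliSum_antitone {p p' : ι → ℝ} (hp : p ∈ Set.Icc (0 : ι → ℝ) 1)
    (hp' : p' ∈ Set.Icc (0 : ι → ℝ) 1) (hpp : p ≤ p') (s : Finset ι)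
    {h : Finset ι → ℝ} (hh : Antitone h) : bernoulliSum p' s h ≤ bernoulliSum p s h := by
  induction s using Finset.induction_on generalizing h with
  | empty => simp [bernoulliSum_empty]
  | insert a s ha ih =>
    have hh' : Antitone fun S => h (insert a S) :=
      fun S T hST => hh (Finset.insert_subset_insert a hST)
    have h1 := ih hh
    have h2 := ih hh'
    have h3 : bernoulliSum p s (fun S => h (insert a S)) ≤ bernoulliSum p s h :=
      bernoulliSum_mono hp s fun S => hh (Finset.subset_insert a S)
    rw [bernoulliSum_insert _ ha, bernoulliSum_insert _ ha]
    have e1 : 0 ≤ 1 - p' a := sub_nonneg.2 (hp'.2 a)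
    have e2 : 0 ≤ p' a := hp'.1 a
    have e3 : 0 ≤ p' a - p a := sub_nonneg.2 (hpp a)
    nlinarith [mul_le_mul_of_nonneg_left h1 e1, mul_le_mul_of_nonneg_left h2 e2,
      mul_le_mul_of_nonneg_left h3 e3]

theorem bernoulliSum_sum {κ : Type*} (p : ι → ℝ) (s : Finset ι) (t : Finset κ) (c : κ → ℝ)
    (h : κ → Finset ι → ℝ) :
    bernoulliSum p s (fun S => ∑ z ∈ t, c z * h z S) =
      ∑ z ∈ t, c z * bernoulliSum p s (h z) := by
  simp only [bernoulliSum, Finset.mul_sum]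
  rw [Finset.sum_comm]
  refine Finset.sum_congr rfl fun z _ => Finset.sum_congr rfl fun S _ => by ring

/-- The sum is affine in each coordinate, so its `k`-th partial derivative at 1 compares `k` present
with `k` absent while everything else is present. -/
theorem hasFDerivAt_bernoulliSum [Fintype ι] (s : Finset ι) (h : Finset ι → ℝ) :
    HasFDerivAt (fun p : ι → ℝ => bernoulliSum p s h)
      (∑ k ∈ s, (h s - h (s.erase k)) • ContinuousLinearMap.proj (R := ℝ) (φ := fun _ => ℝ) k)
      1 := by
  induction s using Finset.induction_on generalizing h with
  | empty =>
    simp only [bernoulliSum_empty, Finset.sum_empty]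
    exact hasFDerivAt_const _ _
  | insert a s ha ih =>
    simp only [bernoulliSum_insert _ ha]
    have hproj : HasFDerivAt (fun p : ι → ℝ => p a)
      (ContinuousLinearMap.proj (R := ℝ) (φ := fun _ : ι => ℝ) a) 1 :=
      (ContinuousLinearMap.proj (R := ℝ) (φ := fun _ : ι => ℝ) a).hasFDerivAt
    have key := ((hproj.const_sub 1).mul (ih h)).add (hproj.mul (ih fun S => h (insert a S)))
    refine key.congr_fderiv ?_
    ext v
    simp only [bernoulliSum_one, Finset.sum_insert ha, Finset.erase_insert ha]
    have : ∀ k ∈ s, (insert a s).erase k = insert a (s.erase k) := fun k hk =>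
      Finset.erase_insert_of_ne (fun h' => ha (h' ▸ hk))
    have hsum : ∑ k ∈ s, (h (insert a s) - h ((insert a s).erase k)) * v k =
        ∑ k ∈ s, (h (insert a s) - h (insert a (s.erase k))) * v k :=
      Finset.sum_congr rfl fun k hk => by rw [this k hk]
    simp [hsum]
    ring

end Bernoulli

/-! ### Grouping subsets of sockets by edge type -/

section Grouping

variable {ι κ : Type*} [DecidableEq κ]

theorem prod_comp_eq_prod_pow_card [Fintype κ] (τ : ι → κ) (S : Finset ι) (x : κ → ℝ) :
    ∏ i ∈ S, x (τ i) = ∏ l, x l ^ #{i ∈ S | τ i = l} := by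
  rw [← Finset.prod_fiberwise S τ (fun i => x (τ i))]
  refine Finset.prod_congr rfl fun l _ => ?_
  rw [Finset.prod_congr rfl (g := fun _ => x l) fun i hi => by rw [(Finset.mem_filter.1 hi).2],
    Finset.prod_const]

variable [DecidableEq ι]

theorem card_filter_insert_add (τ : ι → κ) {j : ι} {S : Finset ι} (hj : j ∉ S) (l : κ) :
    #{i ∈ insert j S | τ i = l} = #{i ∈ S | τ i = l} + (Pi.single (τ j) 1 : κ → ℕ) l := by
  rw [Finset.filter_insert]
  by_cases h : τ j = l
  · subst h
    rw [if_pos rfl, Finset.card_insert_of_notMem (by simp [hj]), Pi.single_eq_same]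
  · rw [if_neg h, Pi.single_eq_of_ne (Ne.symm h)]; rfl

variable [Fintype ι]

theorem card_filter_add_sdiff (τ : ι → κ) (j : ι) {S : Finset ι}
    (hS : S ⊆ univ.erase j) (l : κ) :
    #{i ∈ S | τ i = l} + #{i ∈ univ.erase j \ S | τ i = l} + (Pi.single (τ j) 1 : κ → ℕ) l =
      #{i | τ i = l} := by
  have h1 : #{i ∈ S | τ i = l} + #{i ∈ univ.erase j \ S | τ i = l} =
      #{i ∈ univ.erase j | τ i = l} := by
    rw [← Finset.card_union_of_disjoint, ← Finset.filter_union, Finset.union_sdiff_of_subset hS]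
    exact Finset.disjoint_filter_filter Finset.disjoint_sdiff
  rw [h1, Finset.filter_erase]
  by_cases h : τ j = l
  · subst h
    rw [Finset.card_erase_of_mem (by simp), Pi.single_eq_same]
    have : 0 < #{i | τ i = τ j} := Finset.card_pos.2 ⟨j, by simp⟩
    omega
  · rw [Finset.erase_eq_of_notMem (by simp [h]), Pi.single_eq_of_ne (Ne.symm h)]
    omega

variable [Fintype κ]

/-- Double counting: `insert j S` is a set with a marked element of type `e`, and a set with the
required profile has `#{i | τ i = e} - t e` possible marks. The hypothesis `ht` keeps natural
subtraction from truncating. -/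
theorem sum_insert_eq_mul_sum (τ : ι → κ) (e : κ) (r : Finset ι → ℝ) {t : κ → ℕ}
    (ht : ∀ l, t l + (Pi.single e 1 : κ → ℕ) l ≤ #{i | τ i = l}) :
    ∑ j with τ j = e, ∑ S ∈ (univ.erase j).powerset with
        (fun l => #{i ∈ univ.erase j \ S | τ i = l}) = t, r (insert j S) =
      ((#{i | τ i = e} : ℝ) - t e) *
        ∑ S : Finset ι with ∀ l, #{i ∈ S | τ i = l} = #{i | τ i = l} - t l, r S := by
  have step : ∀ j ∈ univ.filter (fun j => τ j = e),
      ∑ S ∈ (univ.erase j).powerset with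
        (fun l => #{i ∈ univ.erase j \ S | τ i = l}) = t, r (insert j S) =
      ∑ S : Finset ι with j ∈ S ∧ ∀ l, #{i ∈ S | τ i = l} = #{i | τ i = l} - t l, r S := by
    intro j hj
    have hj : τ j = e := by simpa using hj
    subst hj
    refine Finset.sum_nbij' (fun S => insert j S) (fun S => S.erase j) ?_ ?_ ?_ ?_ ?_
    · intro S hS
      simp only [Finset.mem_filter, Finset.mem_powerset] at hS
      obtain ⟨hS, hS'⟩ := hS
      have hjS : j ∉ S := fun h => by simpa using hS h
      simp only [Finset.mem_filter, Finset.mem_univ, true_and, Finset.mem_insert_self]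
      intro l
      have h1 := card_filter_add_sdiff τ j hS l
      have h2 := congrFun hS' l
      have h3 := card_filter_insert_add τ hjS l
      omega
    · intro S hS
      simp only [Finset.mem_filter, Finset.mem_univ, true_and] at hS
      obtain ⟨hjS, hS⟩ := hS
      have hsub : S.erase j ⊆ univ.erase j := Finset.erase_subset_erase _ (Finset.subset_univ _)
      simp only [Finset.mem_filter, Finset.mem_powerset]
      refine ⟨hsub, funext fun l => ?_⟩
      have h1 := card_filter_add_sdiff τ j hsub l
      have h3 := card_filter_insert_add τ (Finset.notMem_erase j S) l
      rw [Finset.insert_erase hjS] at h3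
      have := hS l
      have := ht l
      omega
    · intro S hS
      simp only [Finset.mem_filter, Finset.mem_powerset] at hS
      exact Finset.erase_insert fun h => by simpa using hS.1 h
    · intro S hS
      simp only [Finset.mem_filter, Finset.mem_univ, true_and] at hS
      exact Finset.insert_erase hS.1
    · intros; rfl
  rw [Finset.sum_congr rfl step, Finset.mul_sum,
    Finset.sum_comm' (t' := univ.filter fun S : Finset ι =>
        ∀ l, #{i ∈ S | τ i = l} = #{i | τ i = l} - t l)
      (s' := fun S => S.filter fun j => τ j = e)]
  · refine Finset.sum_congr rfl fun S hS => ?_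
    simp only [Finset.mem_filter, Finset.mem_univ, true_and] at hS
    rw [Finset.sum_const, nsmul_eq_mul, hS e, Nat.cast_sub]
    exact (Nat.le_add_right _ _).trans (ht e)
  · intro j S
    simp only [Finset.mem_filter, Finset.mem_univ, true_and]
    tauto

/-- The companion count: now `j` is marked outside `S`, and the complement of `S` contains `t e + 1`
elements of type `e`, namely `j` and the `t e` others. -/
theorem sum_erase_eq_mul_sum (τ : ι → κ) (e : κ) (r : Finset ι → ℝ) {t : κ → ℕ}
    (ht : ∀ l, t l + (Pi.single e 1 : κ → ℕ) l ≤ #{i | τ i = l}) :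
    ∑ j with τ j = e, ∑ S ∈ (univ.erase j).powerset with
        (fun l => #{i ∈ univ.erase j \ S | τ i = l}) = t, r S =
      ((t e : ℝ) + 1) *
        ∑ S : Finset ι with ∀ l, #{i ∈ S | τ i = l} =
          #{i | τ i = l} - t l - (Pi.single e 1 : κ → ℕ) l, r S := by
  rw [Finset.mul_sum,
    Finset.sum_comm' (t' := univ.filter fun S : Finset ι =>
        ∀ l, #{i ∈ S | τ i = l} = #{i | τ i = l} - t l - (Pi.single e 1 : κ → ℕ) l)
      (s' := fun S => univ.filter fun j => τ j = e ∧ j ∉ S)]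
  · refine Finset.sum_congr rfl fun S hS => ?_
    simp only [Finset.mem_filter, Finset.mem_univ, true_and] at hS
    rw [Finset.sum_const, nsmul_eq_mul]
    congr 1
    have h1 : #{i ∈ S | τ i = e} + #{i | τ i = e ∧ i ∉ S} = #{i | τ i = e} := by
      rw [← Finset.card_union_of_disjoint]
      · congr 1
        ext i
        simp only [Finset.mem_union, Finset.mem_filter, Finset.mem_univ, true_and]
        tauto
      · rw [Finset.disjoint_left]
        intro i hi hi'
        simp only [Finset.mem_filter, Finset.mem_univ, true_and] at hi hi'
        exact hi'.2 hi.1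
    have h2 := hS e
    have h3 := ht e
    rw [Pi.single_eq_same] at h2 h3
    have : #{i | τ i = e ∧ i ∉ S} = t e + 1 := by omega
    rw [this]; push_cast; ring
  · intro j S
    simp only [Finset.mem_filter, Finset.mem_univ, true_and, Finset.mem_powerset]
    constructor
    · rintro ⟨rfl, hS, h⟩
      refine ⟨⟨rfl, fun h' => by simpa using hS h'⟩, fun l => ?_⟩
      have h1 := card_filter_add_sdiff τ j hS l
      have h2 := congrFun h l
      omega
    · rintro ⟨⟨rfl, hj⟩, h⟩
      have hS : S ⊆ univ.erase j := fun x hx => by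
        simp only [Finset.mem_erase, Finset.mem_univ, and_true]
        rintro rfl
        exact hj hx
      refine ⟨rfl, hS, funext fun l => ?_⟩
      have h1 := card_filter_add_sdiff τ j hS l
      have h2 := h l
      have h3 := ht l
      omega

/-- The sum over edge-type profiles in the EXIT functions is a sum, over the sockets of type `e`,
of expectations of increments of the set function `r`. -/
theorem sum_profile_eq_sum_bernoulliSum (τ : ι → κ) (e : κ) (r : Finset ι → ℝ) (I : κ → ℝ) :
    ∑ t ∈ Fintype.piFinset
        (fun l => range (#{i | τ i = l} + 1 - (Pi.single e 1 : κ → ℕ) l)),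
      (∏ l, (1 - I l) ^ t l * I l ^ (#{i | τ i = l} - (Pi.single e 1 : κ → ℕ) l - t l)) *
        (((#{i | τ i = e} : ℝ) - t e) *
            (∑ S : Finset ι with ∀ l, #{i ∈ S | τ i = l} = #{i | τ i = l} - t l, r S)
          - ((t e : ℝ) + 1) * ∑ S : Finset ι with ∀ l, #{i ∈ S | τ i = l} =
              #{i | τ i = l} - t l - (Pi.single e 1 : κ → ℕ) l, r S) =
      ∑ j with τ j = e, bernoulliSum (fun i => I (τ i)) (univ.erase j)
        (fun S => r (insert j S) - r S) := by
  -- Here `t l` counts the sockets of type `l`, other than `j`, missing from `S`. The probability of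
  -- `S` depends only on this profile.
  have hfib : ∀ j ∈ univ.filter (fun j => τ j = e),
      bernoulliSum (fun i => I (τ i)) (univ.erase j) (fun S => r (insert j S) - r S) =
      ∑ t ∈ Fintype.piFinset
        (fun l => range (#{i | τ i = l} + 1 - (Pi.single e 1 : κ → ℕ) l)),
      (∏ l, (1 - I l) ^ t l * I l ^ (#{i | τ i = l} - (Pi.single e 1 : κ → ℕ) l - t l)) *
        (∑ S ∈ (univ.erase j).powerset with
          (fun l => #{i ∈ univ.erase j \ S | τ i = l}) = t, (r (insert j S) - r S)) := by
    intro j hj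
    have hj : τ j = e := by simpa using hj
    subst hj
    unfold bernoulliSum
    rw [← Finset.sum_fiberwise_of_maps_to
      (g := fun S => fun l => #{i ∈ univ.erase j \ S | τ i = l})
      (t := Fintype.piFinset
        (fun l => range (#{i | τ i = l} + 1 - (Pi.single (τ j) 1 : κ → ℕ) l)))]
    · refine Finset.sum_congr rfl fun t _ => ?_
      rw [Finset.mul_sum]
      refine Finset.sum_congr rfl fun S hS => ?_
      simp only [Finset.mem_filter, Finset.mem_powerset] at hS
      obtain ⟨hS, rfl⟩ := hS
      congr 1
      rw [prod_comp_eq_prod_pow_card τ S I,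
        prod_comp_eq_prod_pow_card τ _ (fun l => 1 - I l), mul_comm, ← Finset.prod_mul_distrib]
      refine Finset.prod_congr rfl fun l _ => ?_
      have h1 := card_filter_add_sdiff τ j hS l
      congr 2
      dsimp only
      omega
    · intro S hS
      rw [Fintype.mem_piFinset]
      intro l
      rw [Finset.mem_range]
      have h1 := card_filter_add_sdiff τ j (Finset.mem_powerset.1 hS) l
      omega
  rw [Finset.sum_congr rfl hfib, Finset.sum_comm]
  refine Finset.sum_congr rfl fun t ht => ?_
  have ht : ∀ l, t l + (Pi.single e 1 : κ → ℕ) l ≤ #{i | τ i = l} := by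
    intro l
    have := Finset.mem_range.1 (Fintype.mem_piFinset.1 ht l)
    omega
  rw [← Finset.mul_sum]
  simp only [Finset.sum_sub_distrib]
  rw [sum_insert_eq_mul_sum τ e r ht, sum_erase_eq_mul_sum τ e r ht]

end Grouping

/-! ### Column spans of a generator matrix -/

namespace ComponentCode

open Module in
-- Rank-nullity for the transposed generator matrix. Injectivity ensures that each weight-2 codeword
-- contributes a single power of ε.
theorem encode_injective (K : ComponentCode) : Function.Injective K.encode := by
  have h : Function.Injective (Matrix.mulVecLin K.gen.transpose) := by
    rw [← LinearMap.ker_eq_bot, ← Submodule.finrank_eq_zero]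
    have h1 := LinearMap.finrank_range_add_finrank_ker (Matrix.mulVecLin K.gen.transpose)
    have h2 : finrank (ZMod 2) (LinearMap.range (Matrix.mulVecLin K.gen.transpose)) = K.dim := by
      have := K.rank_gen
      rwa [← Matrix.rank_transpose, Matrix.rank] at this
    rw [h2, Module.finrank_fin_fun] at h1
    omega
  intro x y hxy
  apply h
  simpa only [Matrix.mulVecLin_apply, Matrix.mulVec_transpose] using! hxy

/-- The span of the columns in `S` of the generator matrix and the columns in `U` of the identity
matrix. -/
def colSpan (K : ComponentCode) (S : Finset (Fin K.len)) (U : Finset (Fin K.dim)) :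
    Submodule (ZMod 2) (Fin K.dim → ZMod 2) :=
  Submodule.span (ZMod 2) (K.gen.col '' S ∪ (fun u => Pi.single u 1) '' U)

theorem rank_fromCols_eq_finrank_colSpan (K : ComponentCode) (S : Finset (Fin K.len))
    (U : Finset (Fin K.dim)) :
    (Matrix.fromCols (K.gen.submatrix id (fun i : S => (i : Fin K.len)))
      ((1 : Matrix (Fin K.dim) (Fin K.dim) (ZMod 2)).submatrix id
        (fun i : U => (i : Fin K.dim)))).rank = Module.finrank (ZMod 2) (K.colSpan S U) := by
  rw [Matrix.rank_eq_finrank_span_cols, colSpan]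
  refine congrArg (fun s => Module.finrank (ZMod 2) (Submodule.span (ZMod 2) s))
    (Set.ext fun v => ?_)
  simp only [Set.mem_range, Sum.exists, Set.mem_union, Set.mem_image, Finset.mem_coe,
    Subtype.exists]
  refine or_congr (exists_congr fun i => ⟨?_, ?_⟩) (exists_congr fun i => ⟨?_, ?_⟩)
  · rintro ⟨hi, rfl⟩
    exact ⟨hi, rfl⟩
  · rintro ⟨hi, rfl⟩
    exact ⟨hi, rfl⟩
  · rintro ⟨hi, rfl⟩
    refine ⟨hi, funext fun a => ?_⟩
    simp [Matrix.col, Matrix.one_apply, Pi.single_apply]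
  · rintro ⟨hi, rfl⟩
    refine ⟨hi, funext fun a => ?_⟩
    simp [Matrix.col, Matrix.one_apply, Pi.single_apply]

theorem rank_submatrix_eq_finrank_colSpan (K : ComponentCode) (S : Finset (Fin K.len)) :
    (K.gen.submatrix id (fun i : S => (i : Fin K.len))).rank =
      Module.finrank (ZMod 2) (K.colSpan S ∅) := by
  rw [Matrix.rank_eq_finrank_span_cols, colSpan]
  refine congrArg (fun s => Module.finrank (ZMod 2) (Submodule.span (ZMod 2) s))
    (Set.ext fun v => ?_)
  simp only [Set.mem_range, Set.mem_union, Set.mem_image, Finset.mem_coe, Subtype.exists,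
    Finset.notMem_empty, false_and, exists_false, or_false]
  refine exists_congr fun i => ⟨?_, ?_⟩
  · rintro ⟨hi, rfl⟩
    exact ⟨hi, rfl⟩
  · rintro ⟨hi, rfl⟩
    exact ⟨hi, rfl⟩

theorem colSpan_mono (K : ComponentCode) {S S' : Finset (Fin K.len)} {U U' : Finset (Fin K.dim)}
    (hS : S ⊆ S') (hU : U ⊆ U') : K.colSpan S U ≤ K.colSpan S' U' :=
  Submodule.span_mono (Set.union_subset_union (Set.image_mono (Finset.coe_subset.2 hS))
    (Set.image_mono (Finset.coe_subset.2 hU)))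

theorem colSpan_insert (K : ComponentCode) (j : Fin K.len) (S : Finset (Fin K.len))
    (U : Finset (Fin K.dim)) :
    K.colSpan (insert j S) U = K.colSpan S U ⊔ Submodule.span (ZMod 2) {K.gen.col j} := by
  rw [colSpan, colSpan, ← Submodule.span_union, Finset.coe_insert, Set.image_insert_eq,
    Set.union_singleton, Set.insert_union]

open Classical in
/-- The increment of the rank caused by adding column `j` to the columns in `S` and `U`. -/
noncomputable def rankIncr (K : ComponentCode) (U : Finset (Fin K.dim)) (j : Fin K.len)
    (S : Finset (Fin K.len)) : ℝ :=
  if K.gen.col j ∈ K.colSpan S U then 0 else 1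

theorem finrank_colSpan_insert_sub (K : ComponentCode) (j : Fin K.len) (S : Finset (Fin K.len))
    (U : Finset (Fin K.dim)) :
    (Module.finrank (ZMod 2) (K.colSpan (insert j S) U) : ℝ) -
      Module.finrank (ZMod 2) (K.colSpan S U) = K.rankIncr U j S := by
  rw [colSpan_insert, rankIncr]
  split_ifs with h
  · rw [sup_eq_left.2 (by simpa using h), sub_self]
  · rw [Submodule.finrank_sup_span_singleton h]
    simp

theorem rankIncr_nonneg (K : ComponentCode) (U : Finset (Fin K.dim)) (j : Fin K.len)
    (S : Finset (Fin K.len)) : 0 ≤ K.rankIncr U j S := by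
  unfold rankIncr; split_ifs <;> norm_num

theorem rankIncr_le_one (K : ComponentCode) (U : Finset (Fin K.dim)) (j : Fin K.len)
    (S : Finset (Fin K.len)) : K.rankIncr U j S ≤ 1 := by
  unfold rankIncr; split_ifs <;> norm_num

theorem rankIncr_le_rankIncr (K : ComponentCode) {U U' : Finset (Fin K.dim)} (hU : U ⊆ U')
    (j : Fin K.len) {S S' : Finset (Fin K.len)} (hS : S ⊆ S') :
    K.rankIncr U' j S' ≤ K.rankIncr U j S := by
  unfold rankIncr
  split_ifs with h h' h'
  · exact le_rfl
  · exact zero_le_one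
  · exact absurd (K.colSpan_mono hS hU h') h
  · exact le_rfl

theorem encode_apply (K : ComponentCode) (x : Fin K.dim → ZMod 2) (i : Fin K.len) :
    K.encode x i = x ⬝ᵥ K.gen.col i := rfl

/-- A vector lies outside a subspace iff some functional kills the subspace but not the vector.
Functionals are dot products with input words `x`, their values on columns are code symbols, and a
nonzero value in the binary field is 1. -/
theorem col_notMem_colSpan_iff (K : ComponentCode) (j : Fin K.len) (S : Finset (Fin K.len))
    (U : Finset (Fin K.dim)) :
    K.gen.col j ∉ K.colSpan S U ↔
      ∃ x, K.encode x j = 1 ∧ (∀ i ∈ S, K.encode x i = 0) ∧ ∀ u ∈ U, x u = 0 := by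
  constructor
  · intro h
    obtain ⟨f, hf, hle⟩ := Submodule.exists_le_ker_of_notMem h
    have hfx : ∀ v, f v = (fun u => f (Pi.single u 1)) ⬝ᵥ v := by
      intro v
      conv_lhs => rw [pi_eq_sum_univ' v, map_sum]
      simp only [dotProduct, map_smul, smul_eq_mul, mul_comm]
    refine ⟨fun u => f (Pi.single u 1), ?_, fun i hi => ?_, fun u hu => ?_⟩
    · rw [encode_apply, ← hfx]
      exact Fin.eq_one_of_ne_zero _ hf
    · rw [encode_apply, ← hfx]
      exact hle (Submodule.subset_span (Or.inl ⟨i, hi, rfl⟩))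
    · exact hle (Submodule.subset_span (Or.inr ⟨u, hu, rfl⟩))
  · rintro ⟨x, hj, hS, hU⟩ h
    have hle : K.colSpan S U ≤ LinearMap.ker (dotProductBilin (ZMod 2) (ZMod 2) x) := by
      refine Submodule.span_le.2 ?_
      rintro v (⟨i, hi, rfl⟩ | ⟨u, hu, rfl⟩)
      · exact hS i hi
      · simpa using hU u hu
    have := hle h
    rw [LinearMap.mem_ker] at this
    change x ⬝ᵥ _ = 0 at this
    rw [encode_apply, this] at hj
    exact zero_ne_one hj

theorem minDist_le_hammingNorm (K : ComponentCode) {c : Fin K.len → ZMod 2} (hc : K.IsCodeword c)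
    (h0 : c ≠ 0) : K.minDist ≤ hammingNorm c :=
  iInf_le_of_le c (iInf_le_of_le hc (iInf_le_of_le h0 le_rfl))

theorem not_isCodeword_single (K : ComponentCode) (hK : 2 ≤ K.minDist) (j : Fin K.len) :
    ¬ K.IsCodeword (Pi.single j 1) := by
  intro h
  have h1 := hK.trans (K.minDist_le_hammingNorm h (by simp))
  have h2 : hammingNorm (Pi.single j 1 : Fin K.len → ZMod 2) = 1 := by
    simp [hammingNorm, Pi.single_apply, Finset.filter_eq']
  rw [h2] at h1
  exact absurd h1 (by decide)

/-- A positive increment would produce a codeword of weight 1 supported at `j`. -/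
theorem rankIncr_univ_erase (K : ComponentCode) (hK : 2 ≤ K.minDist) (U : Finset (Fin K.dim))
    (j : Fin K.len) : K.rankIncr U j (univ.erase j) = 0 := by
  rw [rankIncr, if_pos]
  by_contra h
  obtain ⟨x, hj, hS, -⟩ := (K.col_notMem_colSpan_iff j _ U).1 h
  refine K.not_isCodeword_single hK j ⟨x, funext fun i => ?_⟩
  by_cases hi : i = j
  · subst hi; simpa using hj
  · simpa [hi] using hS i (by simpa using hi)

-- The separating input word encodes to a codeword that is 1 at `j` and 0 off `j`, `k`; it cannot
-- vanish at `k`, because its weight would then be 1.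
open Classical in
theorem rankIncr_univ_erase_erase (K : ComponentCode) (hK : 2 ≤ K.minDist)
    (U : Finset (Fin K.dim)) {j k : Fin K.len} (hjk : j ≠ k) :
    K.rankIncr U j ((univ.erase j).erase k) =
      if ∃ x, K.encode x = K.pairWord j k ∧ ∀ u ∈ U, x u = 0 then 1 else 0 := by
  rw [rankIncr, ← ite_not]
  refine if_congr ((K.col_notMem_colSpan_iff j _ U).trans (exists_congr fun x => ?_)) rfl rfl
  rw [← and_assoc]
  refine and_congr_left fun _ => ⟨?_, ?_⟩
  · rintro ⟨hj, hS⟩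
    have hk : K.encode x k ≠ 0 := by
      intro hk
      refine K.not_isCodeword_single hK j ⟨x, funext fun i => ?_⟩
      by_cases hi : i = j
      · subst hi; simpa using hj
      by_cases hi' : i = k
      · subst hi'; simpa [hi] using hk
      · simpa [hi] using hS i (by simp [hi, hi'])
    funext i
    by_cases hi : i = j
    · subst hi; simpa [pairWord] using hj
    by_cases hi' : i = k
    · subst hi'
      rw [show K.encode x i = 1 from Fin.eq_one_of_ne_zero _ hk]
      simp [pairWord]
    · simpa [pairWord, hi, hi'] using hS i (by simp [hi, hi'])
  · intro h
    refine ⟨by simp [h, pairWord], fun i hi => ?_⟩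
    simp only [Finset.mem_erase, Finset.mem_univ, and_true] at hi
    simp [h, pairWord, hi.1, hi.2]

theorem pairWord_ne_zero (K : ComponentCode) (j k : Fin K.len) : K.pairWord j k ≠ 0 := fun h => by
  simpa [pairWord] using congrFun h j

/-- This is why restricting the sums in `matC` and `polyP` to minimum distance exactly 2 loses
nothing. -/
theorem minDist_eq_two (K : ComponentCode) (hK : 2 ≤ K.minDist) {j k : Fin K.len}
    (h : K.IsCodeword (K.pairWord j k)) : K.minDist = 2 := by
  refine le_antisymm ((K.minDist_le_hammingNorm h (K.pairWord_ne_zero j k)).trans ?_) hK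
  have : hammingNorm (K.pairWord j k) ≤ #{j, k} := by
    refine Finset.card_le_card fun i hi => ?_
    by_contra h'
    simp_all [pairWord]
  exact_mod_cast this.trans Finset.card_le_two

end ComponentCode

/-! ### EXIT functions as expectations of rank increments -/

section ExpectExit

theorem comp_mem_Icc {ι κ : Type*} (τ : ι → κ) {I : κ → ℝ} (hI : I ∈ Set.Icc (0 : κ → ℝ) 1) :
    (fun i => I (τ i)) ∈ Set.Icc (0 : ι → ℝ) 1 :=
  ⟨fun i => hI.1 (τ i), fun i => hI.2 (τ i)⟩

variable {ι κ : Type*} [Fintype ι] [DecidableEq ι] [DecidableEq κ]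

/-- One minus the average, over the sockets `j` of type `e`, of the expectation of the increment
`h j S`, where the other sockets `i` belong to `S` with probability `I (τ i)`. -/
noncomputable def expectExit (τ : ι → κ) (h : ι → Finset ι → ℝ) (e : κ) (I : κ → ℝ) : ℝ :=
  1 - 1 / (#{i | τ i = e} : ℝ) *
    ∑ j with τ j = e, bernoulliSum (fun i => I (τ i)) (univ.erase j) (h j)

theorem expectExit_le_one (τ : ι → κ) {h : ι → Finset ι → ℝ} (h0 : ∀ j S, 0 ≤ h j S) (e : κ)
    {I : κ → ℝ} (hI : I ∈ Set.Icc (0 : κ → ℝ) 1) : expectExit τ h e I ≤ 1 := by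
  refine sub_le_self _ (mul_nonneg (by positivity) (Finset.sum_nonneg fun j _ => ?_))
  rw [← bernoulliSum_const (fun i => I (τ i)) (univ.erase j) 0]
  exact bernoulliSum_mono (comp_mem_Icc τ hI) _ (h0 j)

theorem expectExit_nonneg (τ : ι → κ) {h : ι → Finset ι → ℝ} (h1 : ∀ j S, h j S ≤ 1) (e : κ)
    {I : κ → ℝ} (hI : I ∈ Set.Icc (0 : κ → ℝ) 1) : 0 ≤ expectExit τ h e I := by
  have hle : ∑ j with τ j = e, bernoulliSum (fun i => I (τ i)) (univ.erase j) (h j) ≤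
      (#{i | τ i = e} : ℝ) := by
    refine (Finset.sum_le_sum (g := fun _ => (1 : ℝ)) fun j _ => ?_).trans_eq (by simp)
    refine (bernoulliSum_mono (comp_mem_Icc τ hI) _ (h1 j)).trans_eq ?_
    exact bernoulliSum_const _ _ _
  rw [expectExit, sub_nonneg, one_div, inv_mul_eq_div]
  -- This also covers the case of no socket of type `e`, where the quotient is 0.
  exact div_le_one_of_le₀ hle (Nat.cast_nonneg _)

theorem expectExit_monotoneOn (τ : ι → κ) {h : ι → Finset ι → ℝ} (hh : ∀ j, Antitone (h j))
    (e : κ) : MonotoneOn (expectExit τ h e) (Set.Icc 0 1) := by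
  intro I hI I' hI' hII
  refine sub_le_sub_left (mul_le_mul_of_nonneg_left (Finset.sum_le_sum fun j _ => ?_)
    (by positivity)) _
  exact bernoulliSum_antitone (comp_mem_Icc τ hI) (comp_mem_Icc τ hI') (fun i => hII (τ i)) _ (hh j)

theorem expectExit_one (τ : ι → κ) {h : ι → Finset ι → ℝ} (hfull : ∀ j, h j (univ.erase j) = 0)
    (e : κ) : expectExit τ h e 1 = 1 := by
  have : ∀ j, bernoulliSum (fun i => (1 : κ → ℝ) (τ i)) (univ.erase j) (h j) = 0 := fun j => by
    rw [← hfull j]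
    exact bernoulliSum_one _ _
  rw [expectExit, Finset.sum_eq_zero fun j _ => this j, mul_zero, sub_zero]

/-- Chain rule through the linear map `I ↦ I ∘ τ`. Since `h j` vanishes on the full set, the partial
derivatives of the expectations are `-h j` of the sets lacking one socket, and the sign cancels that
in `1 - …`. -/
theorem hasFDerivAt_expectExit [Fintype κ] (τ : ι → κ) {h : ι → Finset ι → ℝ}
    (hfull : ∀ j, h j (univ.erase j) = 0) (e : κ) :
    HasFDerivAt (expectExit τ h e)
      (∑ m, (1 / (#{i | τ i = e} : ℝ) *
        ∑ p : ι × ι with p.1 ≠ p.2 ∧ τ p.1 = e ∧ τ p.2 = m, h p.1 ((univ.erase p.1).erase p.2)) •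
          ContinuousLinearMap.proj (R := ℝ) (φ := fun _ : κ => ℝ) m) 1 := by
  have hL : HasFDerivAt (fun (I : κ → ℝ) (i : ι) => I (τ i))
      (ContinuousLinearMap.pi fun i =>
        ContinuousLinearMap.proj (R := ℝ) (φ := fun _ : κ => ℝ) (τ i)) 1 :=
    (ContinuousLinearMap.pi fun i =>
        ContinuousLinearMap.proj (R := ℝ) (φ := fun _ : κ => ℝ) (τ i)).hasFDerivAt
  have hj : ∀ j ∈ univ.filter (fun j => τ j = e), HasFDerivAt
      (fun I : κ → ℝ => bernoulliSum (fun i => I (τ i)) (univ.erase j) (h j)) _ 1 := fun j _ =>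
    HasFDerivAt.comp (g := fun p : ι → ℝ => bernoulliSum p (univ.erase j) (h j)) (1 : κ → ℝ)
      (hasFDerivAt_bernoulliSum (univ.erase j) (h j)) hL
  refine (((HasFDerivAt.fun_sum hj).const_mul _).const_sub 1).congr_fderiv ?_
  ext v
  simp only [hfull, neg_apply, smul_apply,
    _root_.sum_apply, ContinuousLinearMap.comp_apply, ContinuousLinearMap.pi_apply,
    ContinuousLinearMap.proj_apply, smul_eq_mul, mul_assoc, ← Finset.mul_sum, zero_sub, neg_mul,
    Finset.sum_neg_distrib, mul_neg, neg_neg]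
  congr 1
  -- With the condition on `m` turned into an indicator, the sum over `m` collapses.
  have hsplit : ∀ m, (∑ p : ι × ι with p.1 ≠ p.2 ∧ τ p.1 = e ∧ τ p.2 = m,
      h p.1 ((univ.erase p.1).erase p.2)) * v m =
      ∑ p : ι × ι with p.1 ≠ p.2 ∧ τ p.1 = e,
        if τ p.2 = m then h p.1 ((univ.erase p.1).erase p.2) * v (τ p.2) else 0 := by
    intro m
    rw [← Finset.sum_filter, Finset.filter_filter, Finset.sum_mul]
    simp only [and_assoc]
    refine Finset.sum_congr rfl fun p hp => ?_
    simp only [Finset.mem_filter] at hp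
    rw [hp.2.2.2]
  rw [Finset.sum_congr rfl fun m _ => hsplit m, Finset.sum_comm]
  simp only [Finset.sum_ite_eq, Finset.mem_univ, if_true]
  rw [Finset.sum_sigma']
  refine Finset.sum_nbij' (fun p => (p.1, p.2)) (fun p => ⟨p.1, p.2⟩) ?_ ?_ ?_ ?_ ?_
  · rintro ⟨j, k⟩ hp
    simp only [Finset.mem_sigma, Finset.mem_filter, Finset.mem_univ, true_and, Finset.mem_erase,
      and_true] at hp
    simpa using ⟨fun h' => hp.2 h'.symm, hp.1⟩
  · rintro ⟨j, k⟩ hp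
    simp only [Finset.mem_filter, Finset.mem_univ, true_and] at hp
    simpa using ⟨hp.2, fun h' => hp.1 h'.symm⟩
  · intros; rfl
  · intros; rfl
  · intros; rfl

end ExpectExit

namespace CNType

variable {ne : ℕ} (T : CNType ne)

theorem exit_eq_expectExit (e : Fin ne) (I : Fin ne → ℝ) :
    T.exit e I = expectExit T.edgeType (T.code.rankIncr ∅) e I := by
  have key := sum_profile_eq_sum_bernoulliSum T.edgeType e
    (fun S => (Module.finrank (ZMod 2) (T.code.colSpan S ∅) : ℝ)) I
  simp only [T.code.finrank_colSpan_insert_sub] at key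
  rw [expectExit, ← key]
  simp only [← T.code.rank_submatrix_eq_finrank_colSpan, exit, a, info, s, unitVec, Pi.sub_apply]
  congr! <;> (ext; exact Finset.mem_filter.trans (by simp only [Finset.mem_filter]))

theorem antitone_rankIncr (j : Fin T.code.len) : Antitone (T.code.rankIncr ∅ j) :=
  fun _ _ hS => T.code.rankIncr_le_rankIncr subset_rfl j hS

theorem hasFDerivAt_exit (hT : 2 ≤ T.code.minDist) (e : Fin ne) :
    HasFDerivAt (T.exit e)
      (∑ m, (1 / (T.s e : ℝ) * T.xi e m) •
          ContinuousLinearMap.proj (R := ℝ) (φ := fun _ : Fin ne => ℝ) m) 1 := by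
  rw [funext (T.exit_eq_expectExit e)]
  refine (hasFDerivAt_expectExit T.edgeType (T.code.rankIncr_univ_erase hT ∅) e).congr_fderiv ?_
  refine Finset.sum_congr rfl fun m _ => ?_
  congr 2
  classical
  have : ∀ p ∈ (univ.filter fun p : Fin T.code.len × Fin T.code.len =>
      p.1 ≠ p.2 ∧ T.edgeType p.1 = e ∧ T.edgeType p.2 = m),
      T.code.rankIncr ∅ p.1 ((univ.erase p.1).erase p.2) =
        if T.code.IsCodeword (T.code.pairWord p.1 p.2) then 1 else 0 := by
    intro p hp
    refine (T.code.rankIncr_univ_erase_erase hT ∅ (Finset.mem_filter.1 hp).2.1).trans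
      (if_congr ?_ rfl rfl)
    simp [ComponentCode.IsCodeword]
  rw [Finset.sum_congr rfl this, Finset.sum_boole, Finset.filter_filter, xi]
  simp only [and_assoc]

end CNType

namespace VNType

variable {ne : ℕ} (T : VNType ne)

/-- The increment of the rank caused by socket `j`, averaged over the information bits that are
received over the erasure channel. -/
noncomputable def avgIncr (ε : ℝ) (j : Fin T.code.len) (S : Finset (Fin T.code.len)) : ℝ :=
  ∑ U : Finset (Fin T.code.dim),
    (1 - ε) ^ #U * ε ^ (T.code.dim - #U) * T.code.rankIncr U j S

theorem sum_weight (ε : ℝ) :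
    ∑ U : Finset (Fin T.code.dim), (1 - ε) ^ #U * ε ^ (T.code.dim - #U) = 1 := by
  rw [Fin.sum_pow_mul_eq_add_pow]
  simp

theorem b_eq_dim (hb : ∀ i, T.notPunctured i = true) : T.b = T.code.dim := by
  simp [b, hb]

theorem splitInfo_eq (hb : ∀ i, T.notPunctured i = true) (g : Fin ne → ℕ) (u : ℕ) :
    T.splitInfo g u = ∑ S : Finset (Fin T.code.len) with ∀ l, #{i ∈ S | T.edgeType i = l} = g l,
      ∑ U : Finset (Fin T.code.dim) with #U = u,
        (Module.finrank (ZMod 2) (T.code.colSpan S U) : ℝ) := by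
  simp only [splitInfo, T.code.rank_fromCols_eq_finrank_colSpan, hb, implies_true, true_and]

/-- The index `z` is the number of erased information bits, so sets `U` are grouped by `#U = T.b -
z`; without puncturing `T.b` is the dimension. -/
theorem exit_eq_expectExit (hb : ∀ i, T.notPunctured i = true) (e : Fin ne) (I : Fin ne → ℝ)
    (ε : ℝ) : T.exit e I ε = expectExit T.edgeType (T.avgIncr ε) e I := by
  have havg : ∀ j, T.avgIncr ε j = fun S => ∑ z ∈ range (T.b + 1), (ε ^ z * (1 - ε) ^ (T.b - z)) *
      ∑ U : Finset (Fin T.code.dim) with #U = T.b - z, T.code.rankIncr U j S := by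
    intro j
    funext S
    rw [avgIncr, ← Finset.sum_fiberwise_of_maps_to (g := fun U => T.b - #U)
      (t := range (T.b + 1)) (fun U _ => Finset.mem_range.2 (by omega))]
    refine Finset.sum_congr rfl fun z hz => ?_
    rw [Finset.mem_range] at hz
    rw [Finset.mul_sum]
    have hcard : ∀ U : Finset (Fin T.code.dim), #U ≤ T.b := fun U => by
      rw [T.b_eq_dim hb]; simpa using Finset.card_le_univ U
    refine Finset.sum_congr (Finset.filter_congr fun U _ => ?_) fun U hU => ?_
    · have := hcard U
      omega
    · rw [(Finset.mem_filter.1 hU).2, ← T.b_eq_dim hb, Nat.sub_sub_self (by omega)]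
      ring
  rw [expectExit, exit]
  simp only [havg, bernoulliSum_sum]
  congr 2
  rw [Finset.sum_comm]
  refine Finset.sum_congr rfl fun z _ => ?_
  rw [← Finset.mul_sum]
  congr 1
  have key := sum_profile_eq_sum_bernoulliSum T.edgeType e
    (fun S => ∑ U : Finset (Fin T.code.dim) with #U = T.b - z,
      (Module.finrank (ZMod 2) (T.code.colSpan S U) : ℝ)) I
  simp only [← Finset.sum_sub_distrib, T.code.finrank_colSpan_insert_sub] at key
  rw [← key]
  simp only [a, T.splitInfo_eq hb, q, unitVec, Pi.sub_apply]
  congr! <;> (ext; exact Finset.mem_filter.trans (by simp only [Finset.mem_filter]))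

theorem weight_nonneg {ε : ℝ} (hε : ε ∈ Set.Icc (0 : ℝ) 1) (U : Finset (Fin T.code.dim)) :
    0 ≤ (1 - ε) ^ #U * ε ^ (T.code.dim - #U) :=
  mul_nonneg (pow_nonneg (sub_nonneg.2 hε.2) _) (pow_nonneg hε.1 _)

theorem avgIncr_nonneg {ε : ℝ} (hε : ε ∈ Set.Icc (0 : ℝ) 1)
    (j : Fin T.code.len) (S : Finset (Fin T.code.len)) :
    0 ≤ T.avgIncr ε j S :=
  Finset.sum_nonneg fun U _ => mul_nonneg (T.weight_nonneg hε U) (T.code.rankIncr_nonneg U j S)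

theorem avgIncr_le_one {ε : ℝ} (hε : ε ∈ Set.Icc (0 : ℝ) 1)
    (j : Fin T.code.len) (S : Finset (Fin T.code.len)) :
    T.avgIncr ε j S ≤ 1 := by
  rw [← T.sum_weight ε]
  exact Finset.sum_le_sum fun U _ =>
    mul_le_of_le_one_right (T.weight_nonneg hε U) (T.code.rankIncr_le_one U j S)

theorem antitone_avgIncr {ε : ℝ} (hε : ε ∈ Set.Icc (0 : ℝ) 1)
    (j : Fin T.code.len) : Antitone (T.avgIncr ε j) := fun _ _ hS =>
  Finset.sum_le_sum fun U _ => mul_le_mul_of_nonneg_left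
    (T.code.rankIncr_le_rankIncr subset_rfl j hS) (T.weight_nonneg hε U)

theorem avgIncr_univ_erase (hT : 2 ≤ T.code.minDist) (ε : ℝ) (j : Fin T.code.len) :
    T.avgIncr ε j (univ.erase j) = 0 :=
  Finset.sum_eq_zero fun U _ => by rw [T.code.rankIncr_univ_erase hT, mul_zero]

/-- The probability that every information bit in `s` is erased: factor out `ε ^ #s` and apply the
binomial theorem on the complement. -/
theorem sum_weight_of_disjoint (ε : ℝ) (s : Finset (Fin T.code.dim)) :
    ∑ U ∈ sᶜ.powerset, (1 - ε) ^ #U * ε ^ (T.code.dim - #U) = ε ^ #s := by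
  have h := Finset.sum_pow_mul_eq_add_pow (1 - ε) ε sᶜ
  rw [sub_add_cancel, one_pow] at h
  have h' : ε ^ #s = ε ^ #s * ∑ U ∈ sᶜ.powerset, (1 - ε) ^ #U * ε ^ (#sᶜ - #U) := by
    rw [h, mul_one]
  rw [h', Finset.mul_sum]
  refine Finset.sum_congr rfl fun U hU => ?_
  have h1 := Finset.card_le_card (Finset.mem_powerset.1 hU)
  have h2 : #sᶜ + #s = T.code.dim := by simp
  rw [show T.code.dim - #U = #s + (#sᶜ - #U) by omega, pow_add]
  ring

-- At most one input word `x` encodes to the pair word, and it is nonzero. The increment is 1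
-- exactly when `U` avoids the support of `x`, an event of weight `ε ^ hammingNorm x`.
open Classical in
theorem avgIncr_univ_erase_erase (hT : 2 ≤ T.code.minDist) (ε : ℝ) {j k : Fin T.code.len}
    (hjk : j ≠ k) :
    T.avgIncr ε j ((univ.erase j).erase k) =
      ∑ u ∈ Icc 1 T.code.dim,
        (if ∃ x, hammingNorm x = u ∧ T.code.encode x = T.code.pairWord j k then 1 else 0) *
          ε ^ u := by
  simp only [avgIncr, T.code.rankIncr_univ_erase_erase hT _ hjk]
  by_cases h : ∃ x, T.code.encode x = T.code.pairWord j k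
  · obtain ⟨x, hx⟩ := h
    have huniq : ∀ y, T.code.encode y = T.code.pairWord j k ↔ y = x := fun y =>
      ⟨fun hy => T.code.encode_injective (hy.trans hx.symm), fun hy => hy ▸ hx⟩
    have hx0 : x ≠ 0 := by
      rintro rfl
      refine T.code.pairWord_ne_zero j k (hx.symm.trans ?_)
      simp [ComponentCode.encode]
    simp only [huniq, exists_eq_left, exists_eq_right, mul_ite, mul_one, mul_zero, ite_mul, one_mul,
      zero_mul]
    rw [Finset.sum_ite_eq, if_pos, ← Finset.sum_filter]
    · rw [hammingNorm, ← T.sum_weight_of_disjoint ε]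
      refine Finset.sum_congr (Finset.ext fun U => ?_) fun _ _ => rfl
      simp only [Finset.mem_filter, Finset.mem_univ, true_and, Finset.mem_powerset,
        Finset.subset_iff, Finset.mem_compl, not_not]
    · rw [Finset.mem_Icc]
      exact ⟨hammingNorm_pos_iff.2 hx0, by simpa using hammingNorm_le_card_fintype (x := x)⟩
  · have h1 : ∀ U : Finset (Fin T.code.dim),
        ¬ ∃ x, T.code.encode x = T.code.pairWord j k ∧ ∀ u ∈ U, x u = 0 :=
      fun U ⟨x, hx, _⟩ => h ⟨x, hx⟩
    have h2 : ∀ u, ¬ ∃ x, hammingNorm x = u ∧ T.code.encode x = T.code.pairWord j k :=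
      fun u ⟨x, _, hx⟩ => h ⟨x, hx⟩
    simp [h1, h2]

theorem hasFDerivAt_exit (hb : ∀ i, T.notPunctured i = true) (hT : 2 ≤ T.code.minDist)
    (e : Fin ne) (ε : ℝ) :
    HasFDerivAt (fun I => T.exit e I ε)
      (∑ m, (1 / (T.q e : ℝ) * ∑ u ∈ Icc 1 T.code.dim, (T.chi u e m : ℝ) * ε ^ u) •
          ContinuousLinearMap.proj (R := ℝ) (φ := fun _ : Fin ne => ℝ) m) 1 := by
  rw [funext fun I => T.exit_eq_expectExit hb e I ε]
  refine (hasFDerivAt_expectExit T.edgeType (T.avgIncr_univ_erase hT ε) e).congr_fderiv ?_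
  refine Finset.sum_congr rfl fun m _ => ?_
  congr 2
  classical
  rw [Finset.sum_congr rfl fun p hp =>
    T.avgIncr_univ_erase_erase hT ε (Finset.mem_filter.1 hp).2.1, Finset.sum_comm]
  refine Finset.sum_congr rfl fun u _ => ?_
  rw [← Finset.sum_mul, Finset.sum_boole, Finset.filter_filter, chi]
  simp only [and_assoc]

end VNType

/-! ### The EXIT recursion of an ensemble -/

theorem CNType.xi_eq_zero {ne : ℕ} (T : CNType ne) (hT : 2 ≤ T.code.minDist)
    (h : T.code.minDist ≠ 2) (l m : Fin ne) : T.xi l m = 0 := by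
  classical
  refine Finset.card_eq_zero.2 (Finset.eq_empty_of_forall_notMem fun p hp => ?_)
  obtain ⟨-, -, -, hp⟩ := (Finset.mem_filter.1 hp).2
  exact h (T.code.minDist_eq_two hT hp)

theorem VNType.chi_eq_zero {ne : ℕ} (T : VNType ne) (hT : 2 ≤ T.code.minDist)
    (h : T.code.minDist ≠ 2) (u : ℕ) (l m : Fin ne) : T.chi u l m = 0 := by
  classical
  refine Finset.card_eq_zero.2 (Finset.eq_empty_of_forall_notMem fun p hp => ?_)
  obtain ⟨-, -, -, x, -, hp⟩ := (Finset.mem_filter.1 hp).2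
  exact h (T.code.minDist_eq_two hT ⟨x, hp⟩)

theorem hasFDerivAt_pi_of_coeff {κ : Type*} [Fintype κ] [DecidableEq κ] {F : (κ → ℝ) → κ → ℝ}
    {x : κ → ℝ} (M : Matrix κ κ ℝ)
    (hF : ∀ e, HasFDerivAt (fun y => F y e)
      (∑ m, M e m • ContinuousLinearMap.proj (R := ℝ) (φ := fun _ : κ => ℝ) m) x) :
    HasFDerivAt F (LinearMap.toContinuousLinearMap (Matrix.toLin' M)) x := by
  refine hasFDerivAt_pi'.2 fun e => (hF e).congr_fderiv ?_
  ext v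
  simp [_root_.sum_apply, Matrix.mulVec, dotProduct]

namespace METEnsemble

variable {ne : ℕ} {V C : Type*} [Fintype V] [Fintype C] (𝓔 : METEnsemble ne V C)

theorem matC_apply (hC : ∀ δ, 2 ≤ (𝓔.cn δ).code.minDist) (l m : Fin ne) :
    𝓔.matC l m = ∑ δ, 𝓔.rho δ l * (1 / ((𝓔.cn δ).s l : ℝ) * (𝓔.cn δ).xi l m) := by
  rw [matC, Matrix.of_apply, Finset.sum_filter]
  refine Finset.sum_congr rfl fun δ _ => ?_
  split_ifs with h
  · ring
  · simp [(𝓔.cn δ).xi_eq_zero (hC δ) h]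

theorem matP_apply (hV : ∀ γ, 2 ≤ (𝓔.vn γ).code.minDist) (ε : ℝ) (l m : Fin ne) :
    𝓔.matP ε l m = ∑ γ, 𝓔.lam γ l * (1 / ((𝓔.vn γ).q l : ℝ) *
      ∑ u ∈ Icc 1 (𝓔.vn γ).code.dim, ((𝓔.vn γ).chi u l m : ℝ) * ε ^ u) := by
  simp only [matP, polyP, Matrix.map_apply, Matrix.of_apply, Polynomial.eval_finsetSum,
    Finset.sum_filter, Polynomial.eval_mul, Polynomial.eval_C, Polynomial.eval_pow,
    Polynomial.eval_X, apply_ite (Polynomial.eval ε), Polynomial.eval_zero]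
  refine Finset.sum_congr rfl fun γ _ => ?_
  split_ifs with h
  · ring
  · simp [(𝓔.vn γ).chi_eq_zero (hV γ) h]

theorem matC_nonneg (l m : Fin ne) : 0 ≤ 𝓔.matC l m :=
  Finset.sum_nonneg fun δ _ => mul_nonneg
    (div_nonneg (𝓔.rho_nonneg δ l) (Nat.cast_nonneg _)) (Nat.cast_nonneg _)

theorem matP_nonneg (hV : ∀ γ, 2 ≤ (𝓔.vn γ).code.minDist) {ε : ℝ} (hε : 0 ≤ ε) (l m : Fin ne) :
    0 ≤ 𝓔.matP ε l m := by
  rw [matP_apply 𝓔 hV]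
  exact Finset.sum_nonneg fun γ _ => mul_nonneg (𝓔.lam_nonneg γ l) (by positivity)

theorem exitC_one (hC : ∀ δ, 2 ≤ (𝓔.cn δ).code.minDist) : 𝓔.exitC 1 = 1 := by
  funext e
  have : ∀ δ, (𝓔.cn δ).exit e 1 = 1 := fun δ => by
    rw [CNType.exit_eq_expectExit]
    exact expectExit_one _ ((𝓔.cn δ).code.rankIncr_univ_erase (hC δ) ∅) e
  simp [exitC, this, 𝓔.sum_rho]

theorem hasFDerivAt_exitC (hC : ∀ δ, 2 ≤ (𝓔.cn δ).code.minDist) :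
    HasFDerivAt 𝓔.exitC (LinearMap.toContinuousLinearMap (Matrix.toLin' 𝓔.matC)) 1 := by
  refine hasFDerivAt_pi_of_coeff _ fun e => ?_
  refine (HasFDerivAt.fun_sum fun δ _ =>
    ((𝓔.cn δ).hasFDerivAt_exit (hC δ) e).const_mul (𝓔.rho δ e)).congr_fderiv ?_
  ext v
  simp only [_root_.sum_apply, smul_apply, matC_apply 𝓔 hC, ContinuousLinearMap.proj_apply,
    smul_eq_mul, Finset.mul_sum, Finset.sum_mul]
  rw [Finset.sum_comm]
  simp only [mul_assoc]

theorem exitC_mapsTo : Set.MapsTo 𝓔.exitC (Set.Icc 0 1) (Set.Icc 0 1) := by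
  intro I hI
  refine ⟨fun e => Finset.sum_nonneg fun δ _ => mul_nonneg (𝓔.rho_nonneg δ e) ?_, fun e => ?_⟩
  · rw [CNType.exit_eq_expectExit]
    exact expectExit_nonneg _ ((𝓔.cn δ).code.rankIncr_le_one ∅) e hI
  · refine (Finset.sum_le_sum fun δ _ =>
      mul_le_of_le_one_right (𝓔.rho_nonneg δ e) ?_).trans_eq (𝓔.sum_rho e)
    rw [CNType.exit_eq_expectExit]
    exact expectExit_le_one _ ((𝓔.cn δ).code.rankIncr_nonneg ∅) e hI

theorem exitC_monotoneOn : MonotoneOn 𝓔.exitC (Set.Icc 0 1) := fun I hI I' hI' hII e =>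
  Finset.sum_le_sum fun δ _ => mul_le_mul_of_nonneg_left (by
    rw [CNType.exit_eq_expectExit, CNType.exit_eq_expectExit]
    exact expectExit_monotoneOn _ (𝓔.cn δ).antitone_rankIncr e hI hI' hII) (𝓔.rho_nonneg δ e)

theorem exitV_one (hV : ∀ γ, 2 ≤ (𝓔.vn γ).code.minDist)
    (hb : ∀ γ i, (𝓔.vn γ).notPunctured i = true) (ε : ℝ) : 𝓔.exitV 1 ε = 1 := by
  funext e
  have : ∀ γ, (𝓔.vn γ).exit e 1 ε = 1 := fun γ => by
    rw [VNType.exit_eq_expectExit _ (hb γ)]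
    exact expectExit_one _ ((𝓔.vn γ).avgIncr_univ_erase (hV γ) ε) e
  simp [exitV, this, 𝓔.sum_lam]

theorem hasFDerivAt_exitV (hV : ∀ γ, 2 ≤ (𝓔.vn γ).code.minDist)
    (hb : ∀ γ i, (𝓔.vn γ).notPunctured i = true) (ε : ℝ) :
    HasFDerivAt (fun I => 𝓔.exitV I ε)
      (LinearMap.toContinuousLinearMap (Matrix.toLin' (𝓔.matP ε))) 1 := by
  refine hasFDerivAt_pi_of_coeff _ fun e => ?_
  refine (HasFDerivAt.fun_sum fun γ _ =>
    ((𝓔.vn γ).hasFDerivAt_exit (hb γ) (hV γ) e ε).const_mul (𝓔.lam γ e)).congr_fderiv ?_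
  ext v
  simp only [_root_.sum_apply, smul_apply, matP_apply 𝓔 hV, ContinuousLinearMap.proj_apply,
    smul_eq_mul]
  simp only [Finset.mul_sum (s := (univ : Finset (Fin ne))), Finset.sum_mul (s := univ)]
  rw [Finset.sum_comm]
  simp only [mul_assoc]

theorem exitV_mapsTo (hb : ∀ γ i, (𝓔.vn γ).notPunctured i = true) {ε : ℝ}
    (hε : ε ∈ Set.Icc (0 : ℝ) 1) :
    Set.MapsTo (fun I => 𝓔.exitV I ε) (Set.Icc 0 1) (Set.Icc 0 1) := by
  intro I hI
  refine ⟨fun e => Finset.sum_nonneg fun γ _ => mul_nonneg (𝓔.lam_nonneg γ e) ?_, fun e => ?_⟩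
  · rw [VNType.exit_eq_expectExit _ (hb γ)]
    exact expectExit_nonneg _ ((𝓔.vn γ).avgIncr_le_one hε) e hI
  · refine (Finset.sum_le_sum fun γ _ =>
      mul_le_of_le_one_right (𝓔.lam_nonneg γ e) ?_).trans_eq (𝓔.sum_lam e)
    rw [VNType.exit_eq_expectExit _ (hb γ)]
    exact expectExit_le_one _ ((𝓔.vn γ).avgIncr_nonneg hε) e hI

theorem exitV_monotoneOn (hb : ∀ γ i, (𝓔.vn γ).notPunctured i = true) {ε : ℝ}
    (hε : ε ∈ Set.Icc (0 : ℝ) 1) : MonotoneOn (fun I => 𝓔.exitV I ε) (Set.Icc 0 1) :=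
  fun I hI I' hI' hII e =>
  Finset.sum_le_sum fun γ _ => mul_le_mul_of_nonneg_left (by
    rw [VNType.exit_eq_expectExit _ (hb γ), VNType.exit_eq_expectExit _ (hb γ)]
    exact expectExit_monotoneOn _ ((𝓔.vn γ).antitone_avgIncr hε) e hI hI' hII)
    (𝓔.lam_nonneg γ e)

theorem exitMap_one (hV : ∀ γ, 2 ≤ (𝓔.vn γ).code.minDist)
    (hC : ∀ δ, 2 ≤ (𝓔.cn δ).code.minDist)
    (hb : ∀ γ i, (𝓔.vn γ).notPunctured i = true) (ε : ℝ) : 𝓔.exitMap ε 1 = 1 := by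
  rw [exitMap, 𝓔.exitC_one hC, 𝓔.exitV_one hV hb]

theorem hasFDerivAt_exitMap (hV : ∀ γ, 2 ≤ (𝓔.vn γ).code.minDist)
    (hC : ∀ δ, 2 ≤ (𝓔.cn δ).code.minDist)
    (hb : ∀ γ i, (𝓔.vn γ).notPunctured i = true) (ε : ℝ) :
    HasFDerivAt (𝓔.exitMap ε)
      (LinearMap.toContinuousLinearMap (Matrix.toLin' (𝓔.matP ε * 𝓔.matC))) 1 := by
  have h := 𝓔.hasFDerivAt_exitV hV hb ε
  rw [← 𝓔.exitC_one hC] at h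
  refine (h.comp 1 (𝓔.hasFDerivAt_exitC hC)).congr_fderiv ?_
  ext v : 1
  simp [Matrix.toLin'_mul]

theorem exitMap_mapsTo (hb : ∀ γ i, (𝓔.vn γ).notPunctured i = true) {ε : ℝ}
    (hε : ε ∈ Set.Icc (0 : ℝ) 1) : Set.MapsTo (𝓔.exitMap ε) (Set.Icc 0 1) (Set.Icc 0 1) :=
  (𝓔.exitV_mapsTo hb hε).comp 𝓔.exitC_mapsTo

theorem exitMap_monotoneOn (hb : ∀ γ i, (𝓔.vn γ).notPunctured i = true) {ε : ℝ}
    (hε : ε ∈ Set.Icc (0 : ℝ) 1) : MonotoneOn (𝓔.exitMap ε) (Set.Icc 0 1) :=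
  fun _ hI _ hI' hII => 𝓔.exitV_monotoneOn hb hε (𝓔.exitC_mapsTo hI) (𝓔.exitC_mapsTo hI')
    (𝓔.exitC_monotoneOn hI hI' hII)

end METEnsemble

/-! ### Linearized stability of a fixed point -/

section Stability

theorem IsLocallyStable.isLyapunovStable {E : Type*} [PseudoMetricSpace E] {F : E → E} {S : Set E}
    {p : E} (h : IsLocallyStable F S p) : IsLyapunovStable F S p := by
  obtain ⟨r, hr, K, θ, hθ0, hθ1, hK⟩ := h
  intro η hη
  refine ⟨min r (η / (|K| + 1)), by positivity, fun x hx hxr n => ?_⟩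
  have h1 : dist x p < η / (|K| + 1) := hxr.trans_le (min_le_right _ _)
  rw [lt_div_iff₀ (by positivity)] at h1
  calc dist (F^[n] x) p ≤ K * θ ^ n * dist x p := hK x hx (hxr.trans_le (min_le_left _ _)) n
    _ ≤ |K| * 1 * dist x p := by
      gcongr
      · exact le_abs_self K
      · exact pow_le_one₀ hθ0 hθ1.le
    _ ≤ dist x p * (|K| + 1) := by nlinarith [dist_nonneg (x := x) (y := p)]
    _ < η := h1

theorem IsLocallyStable.isLocalAttractor {E : Type*} [PseudoMetricSpace E] {F : E → E} {S : Set E}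
    {p : E} (h : IsLocallyStable F S p) : IsLocalAttractor F S p := by
  obtain ⟨r, hr, K, θ, hθ0, hθ1, hK⟩ := h
  refine ⟨r, hr, fun x hx hxr => tendsto_iff_dist_tendsto_zero.2 ?_⟩
  refine squeeze_zero (fun _ => dist_nonneg) (hK x hx hxr) ?_
  simpa using ((tendsto_pow_atTop_nhds_zero_of_lt_one hθ0 hθ1).const_mul K).mul_const (dist x p)

theorem HasFDerivAt.eventually_dist_le {E : Type*} [NormedAddCommGroup E] [NormedSpace ℝ E]
    {F : E → E} {A : E →L[ℝ] E} {p : E} (hF : HasFDerivAt F A p) (hp : F p = p) {c : ℝ}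
    (hc : ‖A‖ < c) : ∀ᶠ x in 𝓝 p, dist (F x) p ≤ c * dist x p := by
  filter_upwards [hF.isLittleO.def (sub_pos.2 hc)] with x hx
  rw [hp] at hx
  rw [dist_eq_norm, dist_eq_norm]
  have h1 := norm_add_le (F x - p - A (x - p)) (A (x - p))
  rw [sub_add_cancel] at h1
  have h2 := A.le_opNorm (x - p)
  linarith

/-- A fixed point is locally stable if some power of the derivative is a contraction. -/
theorem isLocallyStable_of_norm_pow_lt_one {E : Type*} [NormedAddCommGroup E] [NormedSpace ℝ E]
    {F : E → E} {A : E →L[ℝ] E} {p : E} (hF : HasFDerivAt F A p) (hp : F p = p) (S : Set E)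
    {N : ℕ} (hN : N ≠ 0) (hA : ‖A ^ N‖ < 1) : IsLocallyStable F S p := by
  obtain ⟨c, hAc, hc1⟩ := exists_between hA
  have hc0 : 0 < c := (norm_nonneg _).trans_lt hAc
  -- The per-step rate for which `N` steps contract by `c`.
  set θ : ℝ := c ^ (N : ℝ)⁻¹ with hθ
  have hθ0 : 0 < θ := Real.rpow_pos_of_pos hc0 _
  have hθ1 : θ < 1 := Real.rpow_lt_one hc0.le hc1 (by positivity)
  have hθN : θ ^ N = c := Real.rpow_inv_natCast_pow hc0.le hN
  have hiter : ∀ n, F^[n] p = p := fun n => Function.iterate_fixed hp n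
  -- A common bound for the fewer than `N` leftover steps; the `+ 1` gives the strict slack over `‖A
  -- ^ i‖`.
  set L : ℝ := ∑ i ∈ range N, (‖A ^ i‖ + 1) with hL
  have hL0 : 0 ≤ L := Finset.sum_nonneg fun i _ => by positivity
  have hstep := (hF.iterate hp N).eventually_dist_le (hiter N) hAc
  have hrem : ∀ᶠ x in 𝓝 p, ∀ i ∈ range N, dist (F^[i] x) p ≤ L * dist x p := by
    rw [Filter.eventually_all_finset]
    intro i hi
    filter_upwards [(hF.iterate hp i).eventually_dist_le (hiter i) (lt_add_one _)] with x hx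
    refine hx.trans (mul_le_mul_of_nonneg_right ?_ dist_nonneg)
    exact Finset.single_le_sum (f := fun i => ‖A ^ i‖ + 1) (fun i _ => by positivity) hi
  obtain ⟨r, hr, hball⟩ := Metric.eventually_nhds_iff.1 (hstep.and hrem)
  refine ⟨r, hr, L / c, θ, hθ0.le, hθ1, fun x _ hxr n => ?_⟩
  have hmul : ∀ m, dist ((F^[N])^[m] x) p ≤ c ^ m * dist x p := by
    intro m
    induction m with
    | zero => simp
    | succ m ih =>
      have hlt : dist ((F^[N])^[m] x) p < r :=
        (ih.trans (mul_le_of_le_one_left dist_nonneg (pow_le_one₀ hc0.le hc1.le))).trans_lt hxr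
      rw [Function.iterate_succ_apply', pow_succ', mul_assoc]
      exact (hball hlt).1.trans (mul_le_mul_of_nonneg_left ih hc0.le)
  have hlt : dist ((F^[N])^[n / N] x) p < r :=
    ((hmul _).trans (mul_le_of_le_one_left dist_nonneg (pow_le_one₀ hc0.le hc1.le))).trans_lt hxr
  have hmod := Nat.mod_lt n (Nat.pos_of_ne_zero hN)
  have hn : F^[n] x = F^[n % N] ((F^[N])^[n / N] x) := by
    rw [← Function.iterate_mul, ← Function.iterate_add_apply, Nat.mod_add_div]
  -- Rounding `n / N` down costs at most one factor `c`, since `n ≤ N * (n / N + 1)`.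
  have hpow : c ^ (n / N) ≤ θ ^ n / c := by
    rw [le_div_iff₀ hc0, ← pow_succ, ← hθN, ← pow_mul]
    refine pow_le_pow_of_le_one hθ0.le hθ1.le ?_
    rw [Nat.mul_succ]
    have := Nat.div_add_mod n N
    omega
  calc dist (F^[n] x) p ≤ L * dist ((F^[N])^[n / N] x) p := by
        rw [hn]; exact (hball hlt).2 _ (Finset.mem_range.2 hmod)
    _ ≤ L * (c ^ (n / N) * dist x p) := mul_le_mul_of_nonneg_left (hmul _) hL0
    _ ≤ L * (θ ^ n / c * dist x p) := by gcongr
    _ = L / c * θ ^ n * dist x p := by ring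

variable {κ : Type*}

theorem eventually_one_sub_smul_mem_Icc [Finite κ] {v : κ → ℝ} (hv : 0 ≤ v) :
    ∀ᶠ t : ℝ in 𝓝[>] 0, 1 - t • v ∈ Set.Icc (0 : κ → ℝ) 1 := by
  have h : ∀ i, ∀ᶠ t : ℝ in 𝓝[>] 0, t * v i < 1 := fun i => by
    have : Tendsto (fun t : ℝ => t * v i) (𝓝[>] 0) (𝓝 (0 * v i)) :=
      (tendsto_nhdsWithin_of_tendsto_nhds tendsto_id).mul_const _
    rw [zero_mul] at this
    exact this.eventually_lt_const one_pos
  filter_upwards [Filter.eventually_all.2 h, self_mem_nhdsWithin] with t ht ht0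
  have ht0 : 0 < t := ht0
  refine ⟨fun i => ?_, fun i => ?_⟩
  · simpa using (ht i).le
  · simpa using mul_nonneg ht0.le (hv i)

theorem tendsto_slope_one_sub_smul [Fintype κ] {F : (κ → ℝ) → κ → ℝ} {A : (κ → ℝ) →L[ℝ] κ → ℝ}
    (hF : HasFDerivAt F A 1) (h1 : F 1 = 1) (v : κ → ℝ) :
    Tendsto (fun t : ℝ => t⁻¹ • (1 - F (1 - t • v))) (𝓝[>] 0) (𝓝 (A v)) := by
  have h := (hF.lim (-v) (c := fun t : ℝ => t⁻¹) (l := 𝓝[>] 0)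
    (tendsto_norm_atTop_atTop.comp tendsto_inv_nhdsGT_zero)).neg
  rw [map_neg, neg_neg] at h
  refine h.congr fun t => ?_
  rw [← smul_neg, neg_sub, h1, inv_inv, smul_neg, sub_eq_add_neg 1 (t • v)]

variable [Fintype κ]

/-- If the top of the unit cube is locally stable, then the powers of the derivative decay
geometrically. -/
theorem IsLocallyStable.exists_norm_pow_le {F : (κ → ℝ) → κ → ℝ} {A : (κ → ℝ) →L[ℝ] κ → ℝ}
    (h : IsLocallyStable F (Set.Icc 0 1) 1) (hF : HasFDerivAt F A 1) (h1 : F 1 = 1) :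
    ∃ K θ : ℝ, 0 ≤ θ ∧ θ < 1 ∧ ∀ n : ℕ, ∀ v, ‖(A ^ n) v‖ ≤ K * θ ^ n * ‖v‖ := by
  obtain ⟨r, hr, K, θ, hθ0, hθ1, hK⟩ := h
  -- For `v ≥ 0` the points `1 - t • v` with small `t > 0` lie in the cube; divide the stability
  -- estimate by `t` and let `t` tend to 0.
  have hpos : ∀ n : ℕ, ∀ v : κ → ℝ, 0 ≤ v → ‖(A ^ n) v‖ ≤ K * θ ^ n * ‖v‖ := by
    intro n v hv
    have hlim := (tendsto_slope_one_sub_smul (hF.iterate h1 n)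
      (Function.iterate_fixed h1 n) v).norm
    refine le_of_tendsto hlim ?_
    have hsmall : ∀ᶠ t : ℝ in 𝓝[>] 0, dist (1 - t • v) 1 < r := by
      have : Tendsto (fun t : ℝ => 1 - t • v) (𝓝[>] 0) (𝓝 (1 - (0 : ℝ) • v)) :=
        tendsto_const_nhds.sub ((tendsto_nhdsWithin_of_tendsto_nhds tendsto_id).smul_const v)
      rw [zero_smul, sub_zero] at this
      exact (Metric.tendsto_nhds.1 this) r hr
    filter_upwards [eventually_one_sub_smul_mem_Icc hv, hsmall, self_mem_nhdsWithin]
      with t ht htr ht0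
    have ht0 : 0 < t := ht0
    have := hK _ ht htr n
    rw [dist_eq_norm, dist_eq_norm, norm_sub_rev, sub_sub_cancel_left, norm_neg, norm_smul,
      Real.norm_of_nonneg ht0.le] at this
    rw [norm_smul, norm_inv, Real.norm_of_nonneg ht0.le, inv_mul_le_iff₀ ht0]
    linarith
  -- The factor 2 comes from `v = v⁺ - v⁻`; the absolute value is needed because the sign of `K` is
  -- unknown.
  refine ⟨2 * |K|, θ, hθ0, hθ1, fun n v => ?_⟩
  have hle : ∀ w : κ → ℝ, 0 ≤ w → ‖w‖ ≤ ‖v‖ → ‖(A ^ n) w‖ ≤ |K| * θ ^ n * ‖v‖ := fun w hw hwv =>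
    (hpos n w hw).trans (by gcongr; exact le_abs_self K)
  have hplus : ‖v⁺‖ ≤ ‖v‖ := (pi_norm_le_iff_of_nonneg (norm_nonneg v)).2 fun i => by
    refine le_trans ?_ (norm_le_pi_norm v i)
    rw [Real.norm_eq_abs, Real.norm_eq_abs, Pi.posPart_apply, abs_of_nonneg (posPart_nonneg _)]
    exact sup_le (le_abs_self _) (abs_nonneg _)
  have hminus : ‖v⁻‖ ≤ ‖v‖ := (pi_norm_le_iff_of_nonneg (norm_nonneg v)).2 fun i => by
    refine le_trans ?_ (norm_le_pi_norm v i)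
    rw [Real.norm_eq_abs, Real.norm_eq_abs, Pi.negPart_apply, abs_of_nonneg (negPart_nonneg _)]
    exact sup_le (neg_le_abs _) (abs_nonneg _)
  calc ‖(A ^ n) v‖ = ‖(A ^ n) v⁺ - (A ^ n) v⁻‖ := by rw [← map_sub, posPart_sub_negPart]
    _ ≤ ‖(A ^ n) v⁺‖ + ‖(A ^ n) v⁻‖ := norm_sub_le _ _
    _ ≤ |K| * θ ^ n * ‖v‖ + |K| * θ ^ n * ‖v‖ :=
      add_le_add (hle _ (posPart_nonneg v) hplus) (hle _ (negPart_nonneg v) hminus)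
    _ = 2 * |K| * θ ^ n * ‖v‖ := by ring

/-- A monotone self-map of the unit cube whose derivative at the top expands a nonnegative
direction drives points that are arbitrarily close to the top away from it. -/
theorem exists_repelling {F : (κ → ℝ) → κ → ℝ} {A : (κ → ℝ) →L[ℝ] κ → ℝ}
    (hF : HasFDerivAt F A 1) (h1 : F 1 = 1) (hmaps : Set.MapsTo F (Set.Icc 0 1) (Set.Icc 0 1))
    (hmono : MonotoneOn F (Set.Icc 0 1)) {v : κ → ℝ} (hv : 0 ≤ v) (hv0 : v ≠ 0) {ρ : ℝ}
    (hρ : 1 < ρ) (hA : ∀ i, ρ * v i ≤ A v i) :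
    ∃ η > 0, ∀ r > 0, ∃ x ∈ Set.Icc (0 : κ → ℝ) 1, dist x 1 < r ∧
      ∀ᶠ n in atTop, η ≤ dist (F^[n] x) 1 := by
  -- Lowering the rate from `ρ` to `c > 1` absorbs the first-order remainder.
  obtain ⟨c, hc1, hcρ⟩ := exists_between hρ
  have hc0 : 0 < c := one_pos.trans hc1
  have hexp : ∀ᶠ t : ℝ in 𝓝[>] 0, ∀ i, F (1 - t • v) i ≤ 1 - c * t * v i := by
    -- Where `v i = 0` there is no strict gain, but the claim is then just that `F` maps into the
    -- cube.
    refine Filter.eventually_all.2 fun i => ?_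
    rcases (hv i).eq_or_lt with hi | hi
    · filter_upwards [eventually_one_sub_smul_mem_Icc hv] with t ht
      rw [← hi]
      simpa using (hmaps ht).2 i
    · have hlim := tendsto_pi_nhds.1 (tendsto_slope_one_sub_smul hF h1 v) i
      have hlt : c * v i < A v i := (mul_lt_mul_of_pos_right hcρ hi).trans_le (hA i)
      filter_upwards [hlim.eventually_const_lt hlt, self_mem_nhdsWithin] with t ht ht0
      have ht0 : 0 < t := ht0
      simp only [Pi.smul_apply, Pi.sub_apply, Pi.one_apply, smul_eq_mul] at ht
      rw [lt_inv_mul_iff₀ ht0] at ht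
      linarith
  obtain ⟨t₀, ht₀, hball⟩ := (nhdsGT_basis (0 : ℝ)).eventually_iff.1
    (hexp.and (eventually_one_sub_smul_mem_Icc hv))
  set T := t₀ / 2 with hT
  have hT0 : 0 < T := by positivity
  have hgood : ∀ t, 0 < t → t ≤ T → (∀ i, F (1 - t • v) i ≤ 1 - c * t * v i) ∧
      1 - t • v ∈ Set.Icc (0 : κ → ℝ) 1 := fun t h0 hle => hball ⟨h0, by
        have : T < t₀ := half_lt_self ht₀
        linarith⟩
  -- Monotonicity compares the orbit with points on the ray `1 - s • v`. The parameter `s` grows by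
  -- the factor `c` at each step but is capped at `T`, beyond which the expansion estimate is not
  -- available.
  have hstay : ∀ t, 0 < t → t ≤ T → ∀ n : ℕ, F^[n] (1 - t • v) ∈ Set.Icc (0 : κ → ℝ) 1 ∧
      F^[n] (1 - t • v) ≤ 1 - min (c ^ n * t) T • v := by
    intro t h0 hle n
    induction n with
    | zero => simpa [min_eq_left hle] using (hgood t h0 hle).2
    | succ n ih =>
      have hs0 : 0 < min (c ^ n * t) T := by positivity
      obtain ⟨hs, hs'⟩ := hgood _ hs0 (min_le_right _ _)
      rw [Function.iterate_succ_apply']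
      refine ⟨hmaps ih.1, (hmono ih.1 hs' ih.2).trans fun i => (hs i).trans ?_⟩
      have hmin : min (c ^ (n + 1) * t) T ≤ c * min (c ^ n * t) T := by
        rw [mul_min_of_nonneg _ _ hc0.le, pow_succ', mul_assoc]
        exact min_le_min_left _ (le_mul_of_one_le_left hT0.le hc1.le)
      have := mul_le_mul_of_nonneg_right hmin (hv i)
      simp only [Pi.sub_apply, Pi.one_apply, Pi.smul_apply, smul_eq_mul]
      linarith
  obtain ⟨i, hi⟩ : ∃ i, 0 < v i := by
    by_contra! hcon
    exact hv0 (le_antisymm hcon hv)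
  -- The gap in coordinate `i` once the cap is reached, independent of how close to 1 the orbit
  -- started.
  refine ⟨T * v i, mul_pos hT0 hi, fun r hr => ?_⟩
  have hsmall : ∀ᶠ t : ℝ in 𝓝[>] 0, dist (1 - t • v) 1 < r := by
    have : Tendsto (fun t : ℝ => 1 - t • v) (𝓝[>] 0) (𝓝 (1 - (0 : ℝ) • v)) :=
      tendsto_const_nhds.sub ((tendsto_nhdsWithin_of_tendsto_nhds tendsto_id).smul_const v)
    rw [zero_smul, sub_zero] at this
    exact (Metric.tendsto_nhds.1 this) r hr
  obtain ⟨t, htr, ht0, htT⟩ := (hsmall.and (Ioc_mem_nhdsGT hT0)).exists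
  refine ⟨1 - t • v, (hgood t ht0 htT).2, htr, ?_⟩
  have hgrow : Tendsto (fun n : ℕ => c ^ n * t) atTop atTop :=
    (tendsto_pow_atTop_atTop_of_one_lt hc1).atTop_mul_const ht0
  filter_upwards [hgrow.eventually_ge_atTop T] with n hn
  have hle := (hstay t ht0 htT n).2 i
  rw [min_eq_right hn] at hle
  simp only [Pi.sub_apply, Pi.one_apply, Pi.smul_apply, smul_eq_mul] at hle
  refine le_trans ?_ (dist_le_pi_dist _ _ i)
  rw [dist_comm, Real.dist_eq]
  refine le_trans ?_ (le_abs_self _)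
  simp only [Pi.one_apply]
  linarith

end Stability

/-! ### The spectral radius of a real matrix -/

section SpecRad

variable {n : ℕ}

theorem exists_eigenvector_of_mem_spectrum {B : Matrix (Fin n) (Fin n) ℂ} {k : ℂ}
    (hk : k ∈ spectrum ℂ B) : ∃ z : Fin n → ℂ, z ≠ 0 ∧ B.mulVec z = k • z := by
  rw [← Matrix.spectrum_toLin', ← Module.End.hasEigenvalue_iff_mem_spectrum] at hk
  obtain ⟨z, hz⟩ := hk.exists_hasEigenvector
  exact ⟨z, hz.2, by simpa using hz.apply_eq_smul⟩

theorem toContinuousLinearMap_toLin'_pow_apply (M : Matrix (Fin n) (Fin n) ℝ) (m : ℕ)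
    (v : Fin n → ℝ) :
    (LinearMap.toContinuousLinearMap (Matrix.toLin' M) ^ m) v = (M ^ m).mulVec v := by
  induction m with
  | zero => simp
  | succ m ih => rw [pow_succ', pow_succ', mul_apply_eq_comp, ih]; simp

theorem map_ofReal_pow (M : Matrix (Fin n) (Fin n) ℝ) (m : ℕ) :
    (M ^ m).map (fun r : ℝ => (r : ℂ)) = M.map (fun r : ℝ => (r : ℂ)) ^ m :=
  map_pow (Complex.ofRealHom.mapMatrix) M m

-- Gelfand's formula in the row-sum norm, which complexification preserves and which is the operator
-- norm for the sup norm on real vectors.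
attribute [local instance] Matrix.linftyOpNormedRing Matrix.linftyOpNormedAlgebra in
theorem exists_norm_pow_lt_one_of_specRad_lt_one {M : Matrix (Fin n) (Fin n) ℝ}
    (hM : specRad M < 1) :
    ∃ N : ℕ, N ≠ 0 ∧ ‖LinearMap.toContinuousLinearMap (Matrix.toLin' M) ^ N‖ < 1 := by
  have hlim := spectrum.pow_nnnorm_pow_one_div_tendsto_nhds_spectralRadius
    (M.map (fun r : ℝ => (r : ℂ)))
  obtain ⟨N, hN, hN0⟩ := ((hlim.eventually_lt_const hM).and (eventually_ne_atTop 0)).exists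
  refine ⟨N, hN0, ?_⟩
  have h1 : ‖(M.map (fun r : ℝ => (r : ℂ))) ^ N‖ < 1 := by
    by_contra! hcon
    refine hN.not_ge (ENNReal.one_le_rpow ?_ (by positivity))
    exact_mod_cast hcon
  have h3 : ‖(M ^ N).map (fun r : ℝ => (r : ℂ))‖ = ‖M ^ N‖ := by
    simp [Matrix.linfty_opNorm_def]
  rw [← map_ofReal_pow, h3, Matrix.linfty_opNorm_eq_opNorm] at h1
  convert h1 using 2
  ext v : 1
  exact toContinuousLinearMap_toLin'_pow_apply M N v

theorem re_mulVec_ofReal (M : Matrix (Fin n) (Fin n) ℝ) (z : Fin n → ℂ) :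
    (fun i => ((M.map (fun r : ℝ => (r : ℂ))).mulVec z i).re) = M.mulVec fun i => (z i).re := by
  funext i
  simp [Matrix.mulVec, dotProduct]

theorem im_mulVec_ofReal (M : Matrix (Fin n) (Fin n) ℝ) (z : Fin n → ℂ) :
    (fun i => ((M.map (fun r : ℝ => (r : ℂ))).mulVec z i).im) = M.mulVec fun i => (z i).im := by
  funext i
  simp [Matrix.mulVec, dotProduct]

attribute [local instance] Matrix.linftyOpNormedRing Matrix.linftyOpNormedAlgebra in
theorem specRad_lt_one_of_forall_lt {M : Matrix (Fin n) (Fin n) ℝ}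
    (h : ∀ k ∈ spectrum ℂ (M.map (fun r : ℝ => (r : ℂ))), ‖k‖ < 1) : specRad M < 1 := by
  -- The empty spectrum is the case `n = 0`, with spectral radius 0. Otherwise the supremum is
  -- attained, so a pointwise strict bound suffices.
  rcases (spectrum ℂ (M.map (fun r : ℝ => (r : ℂ)))).eq_empty_or_nonempty with he | hne
  · simp [specRad, spectralRadius, he]
  · exact_mod_cast spectrum.spectralRadius_lt_of_forall_lt_of_nonempty hne (r := 1)
      fun k hk => by exact_mod_cast h k hk

/-- An eigenvector `z` with `‖k‖ ≥ 1` satisfies `‖z i‖ ≤ ‖k ^ m * z i‖`. The real powers act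
separately on its real and imaginary parts, both of which decay, so `z` would vanish. -/
theorem specRad_lt_one_of_norm_pow_le {M : Matrix (Fin n) (Fin n) ℝ} {K θ : ℝ} (hθ0 : 0 ≤ θ)
    (hθ1 : θ < 1) (h : ∀ m : ℕ, ∀ v,
      ‖(LinearMap.toContinuousLinearMap (Matrix.toLin' M) ^ m) v‖ ≤ K * θ ^ m * ‖v‖) :
    specRad M < 1 := by
  refine specRad_lt_one_of_forall_lt fun k hk => ?_
  obtain ⟨z, hz0, hz⟩ := exists_eigenvector_of_mem_spectrum hk
  by_contra! hk1
  obtain ⟨i, hi⟩ := Function.ne_iff.1 hz0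
  set a : Fin n → ℝ := fun i => (z i).re
  set b : Fin n → ℝ := fun i => (z i).im
  have hpow : ∀ m : ℕ, ((M ^ m).map (fun r : ℝ => (r : ℂ))).mulVec z = k ^ m • z := by
    intro m
    rw [map_ofReal_pow]
    induction m with
    | zero => simp
    | succ m ih => rw [pow_succ, ← Matrix.mulVec_mulVec, hz, Matrix.mulVec_smul, ih, smul_smul,
        pow_succ']
  have hre : ∀ m : ℕ, (LinearMap.toContinuousLinearMap (Matrix.toLin' M) ^ m) a =
      fun i => (k ^ m * z i).re := fun m => by
    rw [toContinuousLinearMap_toLin'_pow_apply, ← re_mulVec_ofReal, hpow]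
    rfl
  have him : ∀ m : ℕ, (LinearMap.toContinuousLinearMap (Matrix.toLin' M) ^ m) b =
      fun i => (k ^ m * z i).im := fun m => by
    rw [toContinuousLinearMap_toLin'_pow_apply, ← im_mulVec_ofReal, hpow]
    rfl
  have hbound : ∀ m : ℕ, ‖z i‖ ≤ K * θ ^ m * (‖a‖ + ‖b‖) := by
    intro m
    have h1 := (norm_le_pi_norm _ i).trans (h m a)
    have h2 := (norm_le_pi_norm _ i).trans (h m b)
    rw [hre m, Real.norm_eq_abs] at h1
    rw [him m, Real.norm_eq_abs] at h2
    calc ‖z i‖ ≤ ‖k ^ m * z i‖ := by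
          rw [norm_mul, norm_pow]
          exact le_mul_of_one_le_left (norm_nonneg _) (one_le_pow₀ hk1)
      _ ≤ |(k ^ m * z i).re| + |(k ^ m * z i).im| := Complex.norm_le_abs_re_add_abs_im _
      _ ≤ K * θ ^ m * ‖a‖ + K * θ ^ m * ‖b‖ := add_le_add h1 h2
      _ = K * θ ^ m * (‖a‖ + ‖b‖) := by ring
  have hlim : Tendsto (fun m : ℕ => K * θ ^ m * (‖a‖ + ‖b‖)) atTop (𝓝 0) := by
    simpa using
      ((tendsto_pow_atTop_nhds_zero_of_lt_one hθ0 hθ1).const_mul K).mul_const (‖a‖ + ‖b‖)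
  exact hi (norm_le_zero_iff.1 (ge_of_tendsto' hlim hbound))

/-- A nonnegative matrix whose spectral radius exceeds one expands some nonnegative vector. -/
theorem exists_expanded_of_one_lt_specRad {M : Matrix (Fin n) (Fin n) ℝ}
    (hM0 : ∀ i j, 0 ≤ M i j) (hM : 1 < specRad M) :
    ∃ v : Fin n → ℝ, 0 ≤ v ∧ v ≠ 0 ∧ ∃ ρ : ℝ, 1 < ρ ∧ ∀ i, ρ * v i ≤ M.mulVec v i := by
  rw [specRad, spectralRadius] at hM
  obtain ⟨k, hM⟩ := lt_iSup_iff.1 hM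
  obtain ⟨hk, hM⟩ := lt_iSup_iff.1 hM
  obtain ⟨z, hz0, hz⟩ := exists_eigenvector_of_mem_spectrum hk
  -- Taking moduli in the eigenvalue equation and using the triangle inequality gives a subinvariant
  -- vector; no Perron–Frobenius eigenvector is needed.
  refine ⟨fun i => ‖z i‖, fun i => norm_nonneg _, fun h => hz0 ?_, ‖k‖, by exact_mod_cast hM,
    fun i => ?_⟩
  · funext i
    exact norm_eq_zero.1 (congrFun h i)
  · calc ‖k‖ * ‖z i‖ = ‖(M.map (fun r : ℝ => (r : ℂ))).mulVec z i‖ := by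
          rw [hz, Pi.smul_apply, smul_eq_mul, norm_mul]
      _ ≤ ∑ j, ‖(M i j : ℂ) * z j‖ := norm_sum_le univ fun j => (M i j : ℂ) * z j
      _ = M.mulVec (fun i => ‖z i‖) i := by
          refine Finset.sum_congr rfl fun j _ => ?_
          rw [norm_mul, Complex.norm_real, Real.norm_of_nonneg (hM0 i j)]

end SpecRad

theorem theorem1 {ne : ℕ} {V C : Type*} [Fintype V] [Fintype C] (𝓔 : METEnsemble ne V C)
    (hV : ∀ γ, 2 ≤ (𝓔.vn γ).code.minDist) (hC : ∀ δ, 2 ≤ (𝓔.cn δ).code.minDist)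
    (hb : ∀ γ i, (𝓔.vn γ).notPunctured i = true)
    (ε : ℝ) (hε : ε ∈ Set.Icc (0 : ℝ) 1) :
    𝓔.exitMap ε 1 = 1 ∧
    HasFDerivAt (𝓔.exitMap ε)
      (LinearMap.toContinuousLinearMap (Matrix.toLin' (𝓔.matP ε * 𝓔.matC))) 1 ∧
    (IsLocallyStable (𝓔.exitMap ε) (Set.Icc 0 1) 1 ↔ specRad (𝓔.matP ε * 𝓔.matC) < 1) ∧
    (specRad (𝓔.matP ε * 𝓔.matC) < 1 →
      IsLyapunovStable (𝓔.exitMap ε) (Set.Icc 0 1) 1 ∧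
      IsLocalAttractor (𝓔.exitMap ε) (Set.Icc 0 1) 1) ∧
    (1 < specRad (𝓔.matP ε * 𝓔.matC) →
      ¬ IsLyapunovStable (𝓔.exitMap ε) (Set.Icc 0 1) 1 ∧
      ¬ IsLocalAttractor (𝓔.exitMap ε) (Set.Icc 0 1) 1) := by
  have hfix := 𝓔.exitMap_one hV hC hb ε
  have hderiv := 𝓔.hasFDerivAt_exitMap hV hC hb ε
  have hstable : specRad (𝓔.matP ε * 𝓔.matC) < 1 →
      IsLocallyStable (𝓔.exitMap ε) (Set.Icc 0 1) 1 := fun h => by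
    obtain ⟨N, hN, hA⟩ := exists_norm_pow_lt_one_of_specRad_lt_one h
    exact isLocallyStable_of_norm_pow_lt_one hderiv hfix _ hN hA
  refine ⟨hfix, hderiv, ⟨fun h => ?_, hstable⟩,
    fun h => ⟨(hstable h).isLyapunovStable, (hstable h).isLocalAttractor⟩, fun h => ?_⟩
  · obtain ⟨K, θ, hθ0, hθ1, hK⟩ := h.exists_norm_pow_le hderiv hfix
    exact specRad_lt_one_of_norm_pow_le hθ0 hθ1 hK
  · have hM0 : ∀ i j, 0 ≤ (𝓔.matP ε * 𝓔.matC) i j := fun i j => by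
      rw [Matrix.mul_apply]
      exact Finset.sum_nonneg fun l _ => mul_nonneg (𝓔.matP_nonneg hV hε.1 i l) (𝓔.matC_nonneg l j)
    obtain ⟨v, hv, hv0, ρ, hρ, hexp⟩ := exists_expanded_of_one_lt_specRad hM0 h
    obtain ⟨η, hη, hrep⟩ := exists_repelling hderiv hfix (𝓔.exitMap_mapsTo hb hε)
      (𝓔.exitMap_monotoneOn hb hε) hv hv0 hρ (fun i => hexp i)
    constructor
    · intro hL
      obtain ⟨r, hr, hr'⟩ := hL η hη
      obtain ⟨x, hx, hxr, hev⟩ := hrep r hr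
      obtain ⟨m, hm⟩ := hev.exists
      exact (hr' x hx hxr m).not_ge hm
    · rintro ⟨r, hr, hr'⟩
      obtain ⟨x, hx, hxr, hev⟩ := hrep r hr
      have hlim := (Metric.tendsto_nhds.1 (hr' x hx hxr)) η hη
      obtain ⟨m, hm, hm'⟩ := (hev.and hlim).exists
      exact hm'.not_ge hm
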